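/- Let $T>0$, let $A\subset\mathbb R^m$ be compact, and let $c:[0,T]\times\mathbb R^d\times A\to\mathbb R$, $f:[0,T]\times\mathbb R^d\times A\to\mathbb R^d$, $q:\mathbb R^d\to\mathbb R$. Put $H(t,x,p)=\inf_{a\in A}[c(t,x,a)+p\cdot f(t,x,a)]$, and suppose that for all $(t,x,p)\in[0,T]\times\mathbb R^d\times\mathbb R^d$ there is a unique minimiser $\alpha(t,x,p)\in A$ of $a\mapsto c(t,x,a)+p\cdot f(t,x,a)$. Assume: (A1) $c,f,q$ are bounded and Lipschitz continuous in all their variables; (A2) $\alpha$ is Lipschitz continuous on $[0,T]\times\mathbb R^d\times\mathbb R^d$; (A3) $q$ is uniformly semi-concave, and $c(t,\cdot,a)$, $f(t,\cdot,a)$ are bounded in $W^{2,\infty}(\mathbb R^d)$ uniformly in $t\in[0,T]$, $a\in A$. Here $g:\mathbb R^d\to\mathbb R$ is called uniformly semi-concave (with constant $C>0$) if $g(x+y)+g(x-y)-2g(x)\le C|y|^2$ for all $x,y\in\mathbb R^d$. Let $N\ge\max\{1,\|f\|_\infty/2\}$, and let $v$ be a bounded continuous viscosity solution on $[0,T]\times\mathbb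 R^d$ of $$\partial_t v+H(t,x,\nabla v)=0\ \text{ in }(0,T)\times\mathbb R^d,\qquad v(T,\cdot)=q .$$ For $\tau,h>0$ with $T/\tau\in\{1,2,\dots\}$ let $V^{\tau,h}$ be the solution on the grid $\Omega_T^{\tau,h}=\{0,\tau,2\tau,\dots,T\}\times h\mathbb Z^d$ of $$\frac{V(t,x)-V(t-\tau,x)}{\tau}+H(t,x,\nabla^hV(t,x))=-Nh\,\Delta^hV(t,x)\quad(t\ne 0),\qquad V(T,x)=q(x),$$ where $\nabla^h\varphi(x)=\big(\tfrac{\varphi(x+he_i)-\varphi(x-he_i)}{2h}\big)_{i=1}^d$ and $\Delta^h\varphi(x)=\sum_{i=1}^d\tfrac{\varphi(x+he_i)-2\varphi(x)+\varphi(x-he_i)}{h^2}$. Then: 1. There is $C>0$ such that for every $t\in[0,T]$ the function $v(t,\cdot)$ is uniformly semi-concave with constant $C$. 2. For each $t\in[0,T]$, for almost every $x\in\mathbb R^d$, the function $v(t,\cdot)$ is differentiable at $x$, and for every choice, for $h\in(0,1)$, of $\tau_h>0$ with $T/\tau_h\in\{1,2,\dots\}$ and $2dN\tau_h\le h$ (the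 CFL condition) and of points $(t_h,x_h)\in\Omega_T^{\tau_h,h}$ with $(t_h,x_h)\to(t,x)$ as $h\to0$, $$\alpha\big(t_h,x_h,\nabla^hV^{\tau_h,h}(t_h,x_h)\big)\to\alpha\big(t,x,\nabla v(t,x)\big)\qquad\text{as }h\to0 .$$ -/

import Mathlib

open Set Filter Topology MeasureTheory
open scoped ContDiff

/-- Euclidean space `ℝⁿ`. -/
abbrev Eu (n : ℕ) : Type := EuclideanSpace ℝ (Fin n)

/-- The standard basis vector `e_i` of `ℝⁿ`. -/
noncomputable def stdVec {d : ℕ} (i : Fin d) : Eu d := EuclideanSpace.single i (1 : ℝ)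

/-- The Hamiltonian `H(t,x,p) = inf_{a ∈ A} [c(t,x,a) + p · f(t,x,a)]`. -/
noncomputable def hamiltonian {d m : ℕ} (A : Set (Eu m)) (c : ℝ → Eu d → Eu m → ℝ)
    (f : ℝ → Eu d → Eu m → Eu d) (t : ℝ) (x p : Eu d) : ℝ :=
  sInf ((fun a : Eu m => c t x a + inner ℝ p (f t x a)) '' A)

/-- `α(t,x,p)` is, for all `t ∈ [0,T]` and all `x, p`, the unique minimiser over `a ∈ A` of
`c(t,x,a) + p · f(t,x,a)`. -/
def IsArgminPolicy {d m : ℕ} (T : ℝ) (A : Set (Eu m)) (c : ℝ → Eu d → Eu m → ℝ)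
    (f : ℝ → Eu d → Eu m → Eu d) (α : ℝ → Eu d → Eu d → Eu m) : Prop :=
  ∀ t ∈ Icc (0 : ℝ) T, ∀ x p : Eu d, α t x p ∈ A ∧
    ∀ a ∈ A, a ≠ α t x p →
      c t x (α t x p) + inner ℝ p (f t x (α t x p)) < c t x a + inner ℝ p (f t x a)

/-- `c`, `f` (on `[0,T] × ℝᵈ × A`) and `q` (on `ℝᵈ`) are bounded and Lipschitz continuous in all
of their variables. -/
def DataBoundedLipschitz {d m : ℕ} (T : ℝ) (A : Set (Eu m)) (c : ℝ → Eu d → Eu m → ℝ)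
    (f : ℝ → Eu d → Eu m → Eu d) (q : Eu d → ℝ) : Prop :=
  ∃ K : ℝ,
    (∀ t ∈ Icc (0 : ℝ) T, ∀ x : Eu d, ∀ a ∈ A, |c t x a| ≤ K ∧ ‖f t x a‖ ≤ K) ∧
    (∀ x : Eu d, |q x| ≤ K) ∧
    (∀ t ∈ Icc (0 : ℝ) T, ∀ s ∈ Icc (0 : ℝ) T, ∀ x y : Eu d, ∀ a ∈ A, ∀ b ∈ A,
      |c t x a - c s y b| ≤ K * (|t - s| + ‖x - y‖ + ‖a - b‖) ∧
      ‖f t x a - f s y b‖ ≤ K * (|t - s| + ‖x - y‖ + ‖a - b‖)) ∧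
    (∀ x y : Eu d, |q x - q y| ≤ K * ‖x - y‖)

/-- The policy map `α` is Lipschitz continuous on `[0,T] × ℝᵈ × ℝᵈ`. -/
def PolicyLipschitz {d m : ℕ} (T : ℝ) (α : ℝ → Eu d → Eu d → Eu m) : Prop :=
  ∃ K : ℝ, ∀ t ∈ Icc (0 : ℝ) T, ∀ s ∈ Icc (0 : ℝ) T, ∀ x y p r : Eu d,
    ‖α t x p - α s y r‖ ≤ K * (|t - s| + ‖x - y‖ + ‖p - r‖)

/-- Semi-concavity with constant `C` on all of `ℝᵈ`. -/
def SemiconcaveWith {d : ℕ} (C : ℝ) (g : Eu d → ℝ) : Prop :=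
  ∀ x y : Eu d, g (x + y) + g (x - y) - 2 * g x ≤ C * ‖y‖ ^ 2

/-- `g` is uniformly semi-concave. -/
def UniformlySemiconcave {d : ℕ} (g : Eu d → ℝ) : Prop :=
  ∃ C : ℝ, 0 < C ∧ SemiconcaveWith C g

/-- The classical partial derivative `∂_i φ`. -/
noncomputable def partialD {d : ℕ} (i : Fin d) (φ : Eu d → ℝ) (x : Eu d) : ℝ :=
  fderiv ℝ φ x (stdVec i)

/-- `g ∈ W^{2,∞}(ℝᵈ)` with `g` and all its weak derivatives of order one and two bounded by `M`
almost everywhere; weak derivatives are taken against compactly supported smooth functions. -/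
def W2InftyBoundedBy {d : ℕ} (M : ℝ) (g : Eu d → ℝ) : Prop :=
  AEStronglyMeasurable g volume ∧ (∀ᵐ x : Eu d, |g x| ≤ M) ∧
  (∀ i : Fin d, ∃ G : Eu d → ℝ, AEStronglyMeasurable G volume ∧ (∀ᵐ x : Eu d, |G x| ≤ M) ∧
    ∀ φ : Eu d → ℝ, ContDiff ℝ ∞ φ → HasCompactSupport φ →
      ∫ x, g x * partialD i φ x = - ∫ x, G x * φ x) ∧
  (∀ i j : Fin d, ∃ G : Eu d → ℝ, AEStronglyMeasurable G volume ∧ (∀ᵐ x : Eu d, |G x| ≤ M) ∧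
    ∀ φ : Eu d → ℝ, ContDiff ℝ ∞ φ → HasCompactSupport φ →
      ∫ x, g x * partialD i (partialD j φ) x = ∫ x, G x * φ x)

/-- `q` is uniformly semi-concave, and `c(t,·,a)` and (the components of) `f(t,·,a)` are bounded in
`W^{2,∞}(ℝᵈ)`, uniformly in `t ∈ [0,T]` and `a ∈ A`. -/
def DataSecondOrder {d m : ℕ} (T : ℝ) (A : Set (Eu m)) (c : ℝ → Eu d → Eu m → ℝ)
    (f : ℝ → Eu d → Eu m → Eu d) (q : Eu d → ℝ) : Prop :=
  UniformlySemiconcave q ∧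
  ∃ M : ℝ, ∀ t ∈ Icc (0 : ℝ) T, ∀ a ∈ A,
    W2InftyBoundedBy M (fun x => c t x a) ∧ ∀ i : Fin d, W2InftyBoundedBy M (fun x => f t x a i)

/-- `v` is a bounded continuous viscosity solution on `[0,T] × ℝᵈ` of the terminal value problem
`∂ₜv + H(t,x,∇v) = 0` in `(0,T) × ℝᵈ`, `v(T,·) = q`.  As the problem is posed backward in time,
`∂ₜφ + H ≥ 0` is required where a test function `φ` touches `v` from above (subsolution), and
`∂ₜφ + H ≤ 0` where it touches `v` from below (supersolution). -/
structure IsViscositySolution {d : ℕ} (T : ℝ) (H : ℝ → Eu d → Eu d → ℝ) (q : Eu d → ℝ)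
    (v : ℝ → Eu d → ℝ) : Prop where
  continuousOn : ContinuousOn (fun z : ℝ × Eu d => v z.1 z.2) (Icc (0 : ℝ) T ×ˢ univ)
  bounded : ∃ M : ℝ, ∀ t ∈ Icc (0 : ℝ) T, ∀ x : Eu d, |v t x| ≤ M
  terminal : ∀ x : Eu d, v T x = q x
  subsolution : ∀ φ : ℝ → Eu d → ℝ, ContDiff ℝ 1 (fun z : ℝ × Eu d => φ z.1 z.2) →
    ∀ t ∈ Ioo (0 : ℝ) T, ∀ x : Eu d,
      IsLocalMax (fun z : ℝ × Eu d => v z.1 z.2 - φ z.1 z.2) (t, x) →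
        0 ≤ deriv (fun s => φ s x) t + H t x (gradient (φ t) x)
  supersolution : ∀ φ : ℝ → Eu d → ℝ, ContDiff ℝ 1 (fun z : ℝ × Eu d => φ z.1 z.2) →
    ∀ t ∈ Ioo (0 : ℝ) T, ∀ x : Eu d,
      IsLocalMin (fun z : ℝ × Eu d => v z.1 z.2 - φ z.1 z.2) (t, x) →
        deriv (fun s => φ s x) t + H t x (gradient (φ t) x) ≤ 0

/-- The central difference gradient `∇ʰ`. -/
noncomputable def gradH {d : ℕ} (h : ℝ) (φ : Eu d → ℝ) (x : Eu d) : Eu d :=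
  WithLp.toLp 2 (fun i : Fin d => (φ (x + h • stdVec i) - φ (x - h • stdVec i)) / (2 * h))

/-- The discrete Laplacian `Δʰ`. -/
noncomputable def laplH {d : ℕ} (h : ℝ) (φ : Eu d → ℝ) (x : Eu d) : ℝ :=
  ∑ i : Fin d, (φ (x + h • stdVec i) - 2 * φ x + φ (x - h • stdVec i)) / h ^ 2

/-- The time grid `{0, τ, 2τ, …, T}` (used when `T / τ` is a positive integer). -/
def timeGrid (T τ : ℝ) : Set ℝ := {t | ∃ k : ℕ, t = k * τ ∧ t ≤ T}

/-- The space grid `h ℤᵈ`. -/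
def spaceGrid (d : ℕ) (h : ℝ) : Set (Eu d) := {x | ∃ z : Fin d → ℤ, ∀ i, x i = h * z i}

/-- `V` solves on the grid the explicit scheme
`∂ₜ^τ V + H(t,x,∇ʰV) = - N h Δʰ V`, `V(T,·) = q`, with
`∂ₜ^τ V(t,x) = (V(t,x) - V(t-τ,x)) / τ`.  Values of `V` off the grid play no role. -/
def IsGridSolution {d : ℕ} (T N τ h : ℝ) (H : ℝ → Eu d → Eu d → ℝ) (q : Eu d → ℝ)
    (V : ℝ → Eu d → ℝ) : Prop :=
  (∀ t ∈ timeGrid T τ \ {0}, ∀ x ∈ spaceGrid d h,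
    (V t x - V (t - τ) x) / τ + H t x (gradH h (V t) x) = - (N * h * laplH h (V t) x)) ∧
  (∀ x ∈ spaceGrid d h, V T x = q x)

/-! With the control frozen, one step of the scheme is an expectation over a random walk with jumps
`± h e_i` and mean displacement `τ f`; minimising over controls makes it a discrete dynamic
programming equation. Uniform convergence at rate `√h` does not control difference quotients at
scale `h`. What is needed is a one-sided second-order bound on `V`, uniform down to the grid scale.
Then discrete slopes are almost monotone, as for a concave function, and a grid-scale slope is
squeezed between slopes at a small fixed scale, which converge to those of `v`.

The bound is `GridJensen`, a Jensen inequality for arbitrary finite laws of grid points, with errors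
for the second moment and for the displacement of the mean. Such laws survive a coupling: when the
base point jumps, each other point makes the same jump or the opposite one, and a finite law around
the new base point results. In `GridJensen.step` the control optimal at the base point is used
everywhere, which is an equality there and an inequality elsewhere. Reversed jumps shift the mean.
Their first-order effect is the difference of drifts, bounded by Jensen for `± f` (this uses the
`W^{2,∞}` bounds). Their quadratic effect would be dangerous where a jump rate is nearly zero;
`SemiconcaveWith.sq_decrease_le`, which says that a nonnegative semi-concave function satisfies
`|∇φ|² ≤ 2Cφ` in integrated form, leaves a noise of size `h / κ` only. A Gronwall argument over the
time grid gives `ControlData.exists_gridJensen`.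

The rate (`ControlData.exists_abs_sub_le`) comes from propagating `v(x) ≤ V(y) + g|x - y|² + B`, and
the reverse inequality, with quadratic barriers on each time strip. In the limit with `κ = √h`,
Jensen passes to `v`, which is thus semi-concave and Lipschitz, hence differentiable almost
everywhere. With `κ = ηh` it yields the squeeze of slopes, so the discrete gradients converge, and
continuity of `α` concludes. -/

/-! ### Semi-concave functions -/

/-- A continuous midpoint-concave function on the real line which vanishes at `0` and `1` is
nonnegative in between. -/
theorem nonneg_of_midpoint_concave {φ : ℝ → ℝ} (hc : Continuous φ) (h0 : φ 0 = 0) (h1 : φ 1 = 0)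
    (hmid : ∀ s r, φ (s + r) + φ (s - r) ≤ 2 * φ s) {s : ℝ} (hs : s ∈ Icc (0 : ℝ) 1) :
    0 ≤ φ s := by
  by_contra! hneg
  obtain ⟨m, hm, hmin⟩ := isCompact_Icc.exists_isMinOn ⟨s, hs⟩ hc.continuousOn
  have hmneg : φ m < 0 := (hmin hs).trans_lt hneg
  have hcomp : IsCompact (Icc (0 : ℝ) 1 ∩ φ ⁻¹' Iic (φ m)) :=
    isCompact_Icc.inter_right (isClosed_Iic.preimage hc)
  -- At the leftmost minimum point `z`, values to the right are no smaller and values to the left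
  -- are strictly larger, against midpoint concavity.
  obtain ⟨z, ⟨hz, hzm⟩, hleast⟩ := hcomp.exists_isLeast ⟨m, hm, le_refl (φ m)⟩
  have hzm : φ z ≤ φ m := hzm
  have hz0 : z ≠ 0 := by rintro rfl; linarith
  have hz1 : z ≠ 1 := by rintro rfl; linarith
  have hpos : 0 < z := lt_of_le_of_ne hz.1 hz0.symm
  have hlt : z < 1 := lt_of_le_of_ne hz.2 hz1
  set r := min z (1 - z) with hr
  have hr0 : 0 < r := lt_min hpos (by linarith)
  have hrz : r ≤ z := min_le_left _ _
  have hr1 : r ≤ 1 - z := min_le_right _ _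
  have hplus : φ m ≤ φ (z + r) := hmin ⟨by linarith, by linarith⟩
  have hminus : φ m < φ (z - r) := by
    by_contra! h
    have := hleast ⟨⟨by linarith, by linarith⟩, h⟩
    linarith
  have := hmid z r
  linarith

/-- A continuous semi-concave function is concave after subtraction of a quadratic. -/
theorem SemiconcaveWith.concaveOn {d : ℕ} {C : ℝ} {g : Eu d → ℝ} (hg : SemiconcaveWith C g)
    (hc : Continuous g) : ConcaveOn ℝ univ (fun x => g x - C / 2 * ‖x‖ ^ 2) := by
  refine ⟨convex_univ, fun x _ y _ a b ha hb hab => ?_⟩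
  set G : Eu d → ℝ := fun x => g x - C / 2 * ‖x‖ ^ 2 with hG
  have hGc : Continuous G := by fun_prop
  have hGmid : ∀ u w : Eu d, G (u + w) + G (u - w) ≤ 2 * G u := by
    intro u w
    have h1 := hg u w
    have h2 := parallelogram_law_with_norm ℝ u w
    simp only [hG]
    linear_combination h1 - C / 2 * h2
  have key := nonneg_of_midpoint_concave
    (φ := fun s => G (x + s • (y - x)) - ((1 - s) * G x + s * G y))
    (by fun_prop) (by simp) (by simp) (fun s r => by
      have := hGmid (x + s • (y - x)) (r • (y - x))
      have e1 : x + (s + r) • (y - x) = x + s • (y - x) + r • (y - x) := by module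
      have e2 : x + (s - r) • (y - x) = x + s • (y - x) - r • (y - x) := by module
      simp only [e1, e2]
      linarith) (s := b) ⟨hb, by linarith⟩
  have ea : a = 1 - b := by linarith
  have e3 : a • x + b • y = x + b • (y - x) := by rw [ea]; module
  simp only [smul_eq_mul] at key ⊢
  rw [e3, ea]
  linarith

/-- Jensen's inequality for a Lipschitz semi-concave function, about an arbitrary base point. -/
theorem SemiconcaveWith.sum_sub_le {d : ℕ} {C K : ℝ} {g : Eu d → ℝ} (hg : SemiconcaveWith C g)
    (hC : 0 ≤ C) (hL : ∀ x y, |g x - g y| ≤ K * ‖x - y‖) {ι : Type} [Fintype ι] {p : ι → ℝ}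
    (hp : ∀ k, 0 ≤ p k) (hp1 : ∑ k, p k = 1) (X : ι → Eu d) (x₀ : Eu d) :
    ∑ k, p k * g (X k) - g x₀ ≤
      K * ‖∑ k, p k • (X k - x₀)‖ + C * ∑ k, p k * ‖X k - x₀‖ ^ 2 := by
  have hc : Continuous g := by
    refine (LipschitzWith.of_dist_le_mul (K := K.toNNReal) fun x y => ?_).continuous
    rw [Real.dist_eq, dist_eq_norm]
    exact (hL x y).trans (mul_le_mul_of_nonneg_right (Real.le_coe_toNNReal K) (norm_nonneg _))
  have hshift : SemiconcaveWith C (fun x => g (x₀ + x)) := by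
    intro x y
    have := hg (x₀ + x) y
    simpa [add_assoc, add_sub_assoc] using this
  -- Jensen for the concave function `g(x₀ + ·) - C/2 ‖·‖²`. The value at the mean displacement is
  -- then compared with `g x₀` by the Lipschitz bound.
  have hJ := (hshift.concaveOn (by fun_prop)).le_map_sum (t := Finset.univ) (w := p)
    (p := fun k => X k - x₀) (fun k _ => hp k) hp1 (fun _ _ => mem_univ _)
  simp only [smul_eq_mul, add_sub_cancel, mul_sub, Finset.sum_sub_distrib] at hJ
  set E := ∑ k, p k • (X k - x₀) with hE
  have h1 := le_of_abs_le (hL (x₀ + E) x₀)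
  rw [add_sub_cancel_left] at h1
  have h2 : ∑ k, p k * (C / 2 * ‖X k - x₀‖ ^ 2) = C / 2 * ∑ k, p k * ‖X k - x₀‖ ^ 2 := by
    rw [Finset.mul_sum]; exact Finset.sum_congr rfl fun _ _ => by ring
  have h3 : 0 ≤ ∑ k, p k * ‖X k - x₀‖ ^ 2 :=
    Finset.sum_nonneg fun k _ => mul_nonneg (hp k) (sq_nonneg _)
  have h4 : 0 ≤ C / 2 * ‖E‖ ^ 2 := by positivity
  have h5 : 0 ≤ C / 2 * ∑ k, p k * ‖X k - x₀‖ ^ 2 := by positivity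
  rw [h2] at hJ
  linarith

/-- A nonnegative semi-concave function decreases slowly where it is small. -/
theorem SemiconcaveWith.sq_decrease_le {d : ℕ} {C : ℝ} {φ : Eu d → ℝ} (hφ : SemiconcaveWith C φ)
    (hC : 0 ≤ C) (hc : Continuous φ) (h0 : ∀ x, 0 ≤ φ x) (x₀ x : Eu d) :
    (max (φ x₀ - φ x) 0) ^ 2 ≤ 2 * C * φ x₀ * ‖x - x₀‖ ^ 2 := by
  rcases le_or_gt (φ x₀ - φ x) 0 with hu | hu
  · rw [max_eq_right hu]
    have := h0 x₀
    rw [zero_pow two_ne_zero]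
    positivity
  rw [max_eq_left hu.le]
  set u := φ x₀ - φ x with hudef
  have hle : u ≤ φ x₀ := by linarith [h0 x]
  have hshift : SemiconcaveWith C (fun z => φ (x₀ + z)) := by
    intro z y
    have := hφ (x₀ + z) y
    simpa [add_assoc, add_sub_assoc] using this
  have hcv := hshift.concaveOn (by fun_prop)
  -- Prolong the segment from `x₀` to `x` by the factor `l`: concavity bounds `φ` at the far end,
  -- where it must still be nonnegative.
  have hext : ∀ l : ℝ, 1 ≤ l → 0 ≤ φ x₀ - l * u + C / 2 * l ^ 2 * ‖x - x₀‖ ^ 2 := by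
    intro l hl
    have hl0 : 0 < l := by linarith
    have ha : 0 ≤ 1 - 1 / l := by rw [sub_nonneg, div_le_one hl0]; exact hl
    have hb : 0 ≤ 1 / l := by positivity
    have h := hcv.2 (mem_univ (0 : Eu d)) (mem_univ (l • (x - x₀))) ha hb (by ring)
    have e : (1 / l) • l • (x - x₀) = x - x₀ := by
      rw [smul_smul, one_div, inv_mul_cancel₀ hl0.ne', one_smul]
    simp only [smul_zero, zero_add, e, norm_zero, add_zero, smul_eq_mul, add_sub_cancel,
      norm_smul, Real.norm_eq_abs, abs_of_pos hl0] at h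
    have h2 : (1 - 1 / l) * (φ x₀ - C / 2 * 0 ^ 2) + 1 / l * (φ (x₀ + l • (x - x₀)) -
        C / 2 * (l * ‖x - x₀‖) ^ 2) = φ x₀ - φ x₀ / l + φ (x₀ + l • (x - x₀)) / l -
        C / 2 * l * ‖x - x₀‖ ^ 2 := by
      field_simp
      ring
    rw [h2] at h
    have h3 : 0 ≤ φ (x₀ + l • (x - x₀)) / l := div_nonneg (h0 _) hl0.le
    have h4 : 0 ≤ C / 2 * ‖x - x₀‖ ^ 2 := by positivity
    have h5 : φ x₀ - φ x₀ / l - C / 2 * l * ‖x - x₀‖ ^ 2 ≤ φ x := by linarith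
    have h6 : l * (φ x₀ - φ x₀ / l - C / 2 * l * ‖x - x₀‖ ^ 2) ≤ l * φ x :=
      mul_le_mul_of_nonneg_left h5 hl0.le
    have h7 : l * (φ x₀ - φ x₀ / l - C / 2 * l * ‖x - x₀‖ ^ 2) =
        l * φ x₀ - φ x₀ - C / 2 * l ^ 2 * ‖x - x₀‖ ^ 2 := by
      field_simp
    rw [h7] at h6
    rw [hudef]
    linarith
  set n := C * ‖x - x₀‖ ^ 2 with hn
  have hn0 : 0 ≤ n := by positivity
  have hext' : ∀ l : ℝ, 1 ≤ l → 0 ≤ φ x₀ - l * u + n * l ^ 2 / 2 := by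
    intro l hl
    have := hext l hl
    have e : C / 2 * l ^ 2 * ‖x - x₀‖ ^ 2 = n * l ^ 2 / 2 := by rw [hn]; ring
    linarith
  -- The best factor is `l = u / n`, admissible when `n < u`. If `u ≤ n`, the trivial bound `u ≤ φ
  -- x₀` suffices; if `n = 0`, a large `l` is contradictory.
  have goal : u ^ 2 ≤ 2 * φ x₀ * n := by
    rcases le_or_gt u n with h | h
    · nlinarith
    · rcases hn0.eq_or_lt with h' | h'
      · exfalso
        have := hext' (φ x₀ / u + 1) (by
          have : 0 ≤ φ x₀ / u := div_nonneg (h0 _) hu.le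
          linarith)
        rw [← h'] at this
        have e : (φ x₀ / u + 1) * u = φ x₀ + u := by field_simp
        rw [e] at this
        linarith
      · have := hext' (u / n) (by rw [le_div_iff₀ h']; linarith)
        have e : φ x₀ - u / n * u + n * (u / n) ^ 2 / 2 = φ x₀ - u ^ 2 / n / 2 := by
          field_simp
          ring
        rw [e] at this
        have : u ^ 2 / n ≤ 2 * φ x₀ := by linarith
        rwa [div_le_iff₀ h'] at this
  calc u ^ 2 ≤ 2 * φ x₀ * n := goal
    _ = _ := by rw [hn]; ring

/-! ### Second differences from weak second derivatives -/

theorem fderiv_eq_sum_partialD {d : ℕ} (ψ : Eu d → ℝ) (x y : Eu d) :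
    fderiv ℝ ψ x y = ∑ i, y i * partialD i ψ x := by
  have hy : y = ∑ i, y i • stdVec i := by
    conv_lhs => rw [← (EuclideanSpace.basisFun (Fin d) ℝ).sum_repr y]
    simp [stdVec]
  conv_lhs => rw [hy]
  simp [map_sum, partialD]

theorem contDiff_partialD {d : ℕ} {ψ : Eu d → ℝ} (hψ : ContDiff ℝ ∞ ψ) (i : Fin d) :
    ContDiff ℝ ∞ (partialD i ψ) := by
  have : ContDiff ℝ ∞ (fderiv ℝ ψ) := hψ.fderiv_right (by simp)
  exact this.clm_apply contDiff_const

theorem hasCompactSupport_partialD {d : ℕ} {ψ : Eu d → ℝ} (hψ : HasCompactSupport ψ) (i : Fin d) :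
    HasCompactSupport (partialD i ψ) :=
  hψ.fderiv_apply ℝ (stdVec i)

theorem partialD_comp_add {d : ℕ} (ψ : Eu d → ℝ) (i : Fin d) (w : Eu d) :
    partialD i (fun z => ψ (z + w)) = fun z => partialD i ψ (z + w) := by
  funext z
  simp [partialD, fderiv_comp_add_right]

theorem hasCompactSupport_comp_add {d : ℕ} {ψ : Eu d → ℝ} (hψ : HasCompactSupport ψ) (w : Eu d) :
    HasCompactSupport (fun z => ψ (z + w)) :=
  hψ.comp_homeomorph (Homeomorph.addRight w)

theorem integrable_mul_of_hasCompactSupport {d : ℕ} {g ψ : Eu d → ℝ} (hg : Continuous g)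
    (hψ : Continuous ψ) (hs : HasCompactSupport ψ) : Integrable (fun z => g z * ψ z) :=
  (hg.mul hψ).integrable_of_hasCompactSupport hs.mul_left

/-- Differentiation of `s ↦ ∫ g(z) ψ(z + s y) dz`. -/
theorem hasDerivAt_integral_mul_translate {d : ℕ} {g ψ : Eu d → ℝ} (hg : Continuous g)
    (hψ : ContDiff ℝ ∞ ψ) (hs : HasCompactSupport ψ) (y : Eu d) (s₀ : ℝ) :
    HasDerivAt (fun s : ℝ => ∫ z, g z * ψ (z + s • y))
      (∑ i, y i * ∫ z, g z * partialD i ψ (z + s₀ • y)) s₀ := by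
  set ψ' : Eu d → ℝ := fun z => fderiv ℝ ψ z y with hψ'
  have hψ'c : Continuous ψ' := (hψ.continuous_fderiv (by simp)).clm_apply continuous_const
  have hψ's : HasCompactSupport ψ' := hs.fderiv_apply ℝ y
  obtain ⟨R, hR⟩ := hψ's.isCompact.isBounded.subset_closedBall (0 : Eu d)
  obtain ⟨c, hc⟩ := hψ's.exists_bound_of_continuous hψ'c
  -- For `|s - s₀| < 1` all translates of the support lie in one ball of radius `R'`, which provides
  -- the dominating function.
  set R' := R + (|s₀| + 1) * ‖y‖ with hR'
  set bound : Eu d → ℝ := (Metric.closedBall (0 : Eu d) R').indicator (fun z => ‖g z‖ * c)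
  have hbi : Integrable bound := by
    refine IntegrableOn.integrable_indicator ?_ measurableSet_closedBall
    exact ((hg.norm.mul continuous_const).continuousOn).integrableOn_compact
      (isCompact_closedBall _ _)
  have hmain := hasDerivAt_integral_of_dominated_loc_of_deriv_le (μ := volume)
    (F := fun (s : ℝ) (z : Eu d) => g z * ψ (z + s • y))
    (F' := fun (s : ℝ) (z : Eu d) => g z * ψ' (z + s • y)) (x₀ := s₀)
    (s := Metric.ball s₀ 1) (bound := bound) (Metric.ball_mem_nhds _ one_pos)
    (Eventually.of_forall fun s => by
      have := hψ.continuous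
      exact (hg.mul (by fun_prop)).aestronglyMeasurable)
    (integrable_mul_of_hasCompactSupport hg (by have := hψ.continuous; fun_prop)
      (hasCompactSupport_comp_add hs _))
    (hg.mul (by fun_prop)).aestronglyMeasurable
    (Eventually.of_forall fun z s hsb => by
      by_cases hz : z ∈ Metric.closedBall (0 : Eu d) R'
      · simp only [bound, indicator_of_mem hz, norm_mul]
        exact mul_le_mul_of_nonneg_left (hc _) (norm_nonneg _)
      · have hzero : ψ' (z + s • y) = 0 := by
          by_contra hne
          have h1 := hR (subset_tsupport _ hne)
          rw [mem_closedBall_zero_iff] at h1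
          apply hz
          rw [mem_closedBall_zero_iff]
          have h2 : |s| ≤ |s₀| + 1 := by
            have h3 : |s - s₀| < 1 := by simpa [Real.dist_eq] using hsb
            have h4 := abs_add_le (s - s₀) s₀
            rw [sub_add_cancel] at h4
            linarith
          calc ‖z‖ = ‖(z + s • y) - s • y‖ := by rw [add_sub_cancel_right]
            _ ≤ ‖z + s • y‖ + ‖s • y‖ := norm_sub_le _ _
            _ ≤ R + (|s₀| + 1) * ‖y‖ := by
              rw [norm_smul, Real.norm_eq_abs]
              gcongr
        simp [bound, indicator_of_notMem hz, hzero])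
    hbi
    (Eventually.of_forall fun z s _ => by
      have h1 : HasFDerivAt ψ (fderiv ℝ ψ (z + s • y)) (z + s • y) :=
        (hψ.differentiable (by simp)).differentiableAt.hasFDerivAt
      have h2 : HasDerivAt (fun s : ℝ => z + s • y) y s := by
        simpa using ((hasDerivAt_id s).smul_const y).const_add z
      exact (h1.comp_hasDerivAt s h2).const_mul (g z))
  convert! hmain.2 using 1
  simp only [hψ', fderiv_eq_sum_partialD, Finset.mul_sum]
  rw [integral_finsetSum]
  · refine Finset.sum_congr rfl fun i _ => ?_
    rw [← integral_const_mul]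
    exact integral_congr_ae (Eventually.of_forall fun z => by simp only; ring)
  · intro i _
    have h1 := integrable_mul_of_hasCompactSupport hg
      (ψ := fun z => partialD i ψ (z + s₀ • y))
      (by have := (contDiff_partialD hψ i).continuous; fun_prop)
      (hasCompactSupport_comp_add (hasCompactSupport_partialD hs i) _)
    refine (h1.const_mul (y i)).congr (Eventually.of_forall fun z => by simp only; ring)

/-- A bound on the second derivative bounds the symmetric second difference. -/
theorem abs_second_difference_le {F F' F'' : ℝ → ℝ} {m : ℝ} (h1 : ∀ s, HasDerivAt F (F' s) s)
    (h2 : ∀ s, HasDerivAt F' (F'' s) s) (hm : ∀ s, |F'' s| ≤ m) :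
    |F 1 + F (-1) - 2 * F 0| ≤ 2 * m := by
  have hk : ∀ s, HasDerivAt (fun s => F s + F (-s)) (F' s - F' (-s)) s := by
    intro s
    have h := (h1 (-s)).comp s (hasDerivAt_neg s)
    have h3 := (h1 s).add h
    simp only [mul_neg, mul_one, ← sub_eq_add_neg] at h3
    exact h3
  -- Mean value theorem for `s ↦ F s + F (-s)` on `[0,1]`, then for `F'` on `[-a,a]`.
  obtain ⟨a, ha, hae⟩ := exists_hasDerivAt_eq_slope (fun s => F s + F (-s)) _ (zero_lt_one)
    (fun s _ => (hk s).continuousAt.continuousWithinAt) (fun s _ => hk s)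
  obtain ⟨b, hb, hbe⟩ := exists_hasDerivAt_eq_slope F' F'' (show -a < a by linarith [ha.1])
    (fun s _ => (h2 s).continuousAt.continuousWithinAt) (fun s _ => h2 s)
  have ha0 : 0 < a - -a := by linarith [ha.1]
  have e1 : F' a - F' (-a) = F'' b * (a - -a) := by rw [hbe, div_mul_cancel₀ _ ha0.ne']
  have e2 : F 1 + F (-1) - 2 * F 0 = F'' b * (a - -a) := by
    rw [← e1, hae]; simp; ring
  rw [e2, abs_mul, abs_of_pos ha0]
  have := (abs_nonneg _).trans (hm b)
  calc |F'' b| * (a - -a) ≤ m * 2 :=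
        mul_le_mul (hm b) (by linarith [ha.2]) ha0.le this
    _ = 2 * m := by ring

/-- Lipschitz functions with bounded weak second derivatives have bounded second differences. -/
theorem W2InftyBoundedBy.abs_second_difference_le {d : ℕ} {M K : ℝ} {g : Eu d → ℝ}
    (hW : W2InftyBoundedBy M g) (hL : ∀ x y, |g x - g y| ≤ K * ‖x - y‖) (x y : Eu d) :
    |g (x + y) + g (x - y) - 2 * g x| ≤ 2 * (|M| * d ^ 2) * ‖y‖ ^ 2 := by
  have hc : Continuous g := by
    refine (LipschitzWith.of_dist_le_mul (K := K.toNNReal) fun x y => ?_).continuous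
    rw [Real.dist_eq, dist_eq_norm]
    exact (hL x y).trans (mul_le_mul_of_nonneg_right (Real.le_coe_toNNReal K) (norm_nonneg _))
  refine le_of_forall_pos_le_add fun ε hε => ?_
  -- The second difference carries four mollification errors of size `|K| r`, the middle value
  -- counting twice.
  set r : ℝ := ε / (4 * (|K| + 1)) with hr
  have hr0 : 0 < r := by positivity
  let b : ContDiffBump x := ⟨r / 2, r, by linarith, by linarith⟩
  set ρ : Eu d → ℝ := b.normed volume with hρ
  have hρs : ContDiff ℝ ∞ ρ := b.contDiff_normed (n := ⊤)
  have hρc : HasCompactSupport ρ := b.hasCompactSupport_normed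
  have hρ0 : ∀ z, 0 ≤ ρ z := fun z => b.nonneg_normed z
  have hρ1 : ∫ z, ρ z = 1 := b.integral_normed
  have hρi : Integrable ρ := b.integrable_normed
  -- `F s` mollifies `g` at `x - s y`. Its derivatives fall on the mollifier and return to `g` as
  -- weak derivatives, averaged against a probability density.
  set F : ℝ → ℝ := fun s => ∫ z, g z * ρ (z + s • y) with hF
  set F' : ℝ → ℝ := fun s => ∑ i, y i * ∫ z, g z * partialD i ρ (z + s • y) with hF'
  set F'' : ℝ → ℝ := fun s => ∑ i, y i * ∑ j, y j * ∫ z, g z *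
    partialD j (partialD i ρ) (z + s • y) with hF''
  have d1 : ∀ s, HasDerivAt F (F' s) s := hasDerivAt_integral_mul_translate hc hρs hρc y
  have d2 : ∀ s, HasDerivAt F' (F'' s) s := fun s =>
    HasDerivAt.fun_sum fun i _ => (hasDerivAt_integral_mul_translate hc (contDiff_partialD hρs i)
      (hasCompactSupport_partialD hρc i) y s).const_mul (y i)
  have hcoord : ∀ i, |y i| ≤ ‖y‖ := fun i => by
    simpa using PiLp.norm_apply_le y i
  have hb : ∀ (s : ℝ) (i j : Fin d), |∫ z, g z * partialD j (partialD i ρ) (z + s • y)| ≤ |M| := by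
    intro s i j
    obtain ⟨G, -, hGM, hG⟩ := hW.2.2.2 j i
    have hw := hG (fun z => ρ (z + s • y)) (hρs.comp (contDiff_id.add contDiff_const))
      (hasCompactSupport_comp_add hρc _)
    rw [partialD_comp_add, partialD_comp_add] at hw
    rw [hw]
    have hint : Integrable (fun z => ρ (z + s • y)) := hρi.comp_add_right _
    have := norm_integral_le_of_norm_le (f := fun z => G z * ρ (z + s • y))
      (hint.const_mul |M|) (by
        filter_upwards [hGM] with z hz
        rw [norm_mul, Real.norm_eq_abs, Real.norm_eq_abs, abs_of_nonneg (hρ0 _)]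
        exact mul_le_mul_of_nonneg_right (hz.trans (le_abs_self _)) (hρ0 _))
    rw [integral_const_mul, integral_add_right_eq_self ρ, hρ1, mul_one] at this
    exact this
  have hm : ∀ s, |F'' s| ≤ |M| * d ^ 2 * ‖y‖ ^ 2 := by
    intro s
    calc |F'' s| ≤ ∑ i : Fin d, ∑ j : Fin d, ‖y‖ * (‖y‖ * |M|) := by
          refine (Finset.abs_sum_le_sum_abs _ _).trans (Finset.sum_le_sum fun i _ => ?_)
          rw [abs_mul, ← Finset.mul_sum]
          refine mul_le_mul (hcoord i) ?_ (abs_nonneg _) (norm_nonneg _)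
          refine (Finset.abs_sum_le_sum_abs _ _).trans (Finset.sum_le_sum fun j _ => ?_)
          rw [abs_mul]
          exact mul_le_mul (hcoord j) (hb s i j) (abs_nonneg _) (norm_nonneg _)
      _ = _ := by simp; ring
  have hFd := _root_.abs_second_difference_le d1 d2 hm
  have happ : ∀ s : ℝ, |F s - g (x - s • y)| ≤ |K| * r := by
    intro s
    have e1 : F s = ∫ z, g (z - s • y) * ρ z := by
      rw [hF, ← integral_add_right_eq_self (fun z => g (z - s • y) * ρ z) (s • y)]
      simp
    have e2 : g (x - s • y) = ∫ z, g (x - s • y) * ρ z := by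
      rw [integral_const_mul, hρ1, mul_one]
    rw [e1, e2, ← integral_sub]
    · have := norm_integral_le_of_norm_le (f := fun z => g (z - s • y) * ρ z - g (x - s • y) * ρ z)
        (hρi.const_mul (|K| * r)) (Eventually.of_forall fun z => by
          rw [← sub_mul, norm_mul, Real.norm_eq_abs, Real.norm_eq_abs, abs_of_nonneg (hρ0 _)]
          by_cases hz : ρ z = 0
          · simp [hz]
          · refine mul_le_mul_of_nonneg_right ?_ (hρ0 _)
            have hz' : z ∈ Function.support ρ := hz
            rw [hρ, b.support_normed_eq, Metric.mem_ball, dist_eq_norm] at hz'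
            have h1 := hL (z - s • y) (x - s • y)
            rw [sub_sub_sub_cancel_right] at h1
            exact h1.trans (mul_le_mul (le_abs_self K) hz'.le (norm_nonneg _) (abs_nonneg _)))
      rw [integral_const_mul, hρ1, mul_one] at this
      exact this
    · exact integrable_mul_of_hasCompactSupport (by fun_prop) hρs.continuous hρc
    · exact hρi.const_mul _
  have a1 := happ 1
  have a2 := happ (-1)
  have a3 := happ 0
  simp only [one_smul, neg_smul, sub_neg_eq_add, zero_smul, sub_zero] at a1 a2 a3
  have hKr : 4 * (|K| * r) ≤ ε := by
    have : r * (4 * (|K| + 1)) = ε := by rw [hr]; field_simp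
    nlinarith
  rw [abs_le] at hFd a1 a2 a3 ⊢
  constructor <;> linarith [hFd.1, hFd.2, a1.1, a1.2, a2.1, a2.2, a3.1, a3.2]

theorem W2InftyBoundedBy.semiconcaveWith {d : ℕ} {M K : ℝ} {g : Eu d → ℝ}
    (hW : W2InftyBoundedBy M g) (hL : ∀ x y, |g x - g y| ≤ K * ‖x - y‖) :
    SemiconcaveWith (2 * (|M| * d ^ 2)) g ∧ SemiconcaveWith (2 * (|M| * d ^ 2)) (fun x => -g x) :=
  ⟨fun x y => (le_abs_self _).trans (hW.abs_second_difference_le hL x y), fun x y => by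
    have := (neg_le_abs _).trans (hW.abs_second_difference_le hL x y)
    simp only
    linarith⟩

/-! ### Jensen inequality on the grid and coupled jumps -/

/-- An approximate Jensen inequality on the grid `h ℤᵈ`: the average of `V` over a finite
probability distribution exceeds the value at a base point by at most `A` times the second moment
plus `B` times a regularised norm of the displacement of the mean. -/
def GridJensen {d : ℕ} (h A B κ : ℝ) (V : Eu d → ℝ) : Prop :=
  ∀ (ι : Type) [Fintype ι] (p : ι → ℝ) (X : ι → Eu d) (x₀ : Eu d), (∀ k, 0 ≤ p k) →
    ∑ k, p k = 1 → (∀ k, X k ∈ spaceGrid d h) → x₀ ∈ spaceGrid d h →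
    ∑ k, p k * V (X k) - V x₀ ≤ A * ∑ k, p k * ‖X k - x₀‖ ^ 2 +
      B * √(κ ^ 2 + ‖∑ k, p k • (X k - x₀)‖ ^ 2)

theorem spaceGrid_add {d : ℕ} {h : ℝ} {x y : Eu d} (hx : x ∈ spaceGrid d h)
    (hy : y ∈ spaceGrid d h) : x + y ∈ spaceGrid d h := by
  obtain ⟨z, hz⟩ := hx
  obtain ⟨w, hw⟩ := hy
  exact ⟨z + w, fun i => by simp [hz i, hw i]; ring⟩

theorem spaceGrid_neg {d : ℕ} {h : ℝ} {x : Eu d} (hx : x ∈ spaceGrid d h) :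
    -x ∈ spaceGrid d h := by
  obtain ⟨z, hz⟩ := hx
  exact ⟨-z, fun i => by simp [hz i]⟩

theorem spaceGrid_sub {d : ℕ} {h : ℝ} {x y : Eu d} (hx : x ∈ spaceGrid d h)
    (hy : y ∈ spaceGrid d h) : x - y ∈ spaceGrid d h := by
  rw [sub_eq_add_neg]
  exact spaceGrid_add hx (spaceGrid_neg hy)

theorem smul_stdVec_mem_spaceGrid {d : ℕ} (h : ℝ) (n : ℤ) (i : Fin d) :
    (h * n) • stdVec i ∈ spaceGrid d h :=
  ⟨Pi.single i n, fun j => by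
    by_cases hj : j = i
    · subst hj; simp [stdVec]
    · simp [stdVec, hj]⟩

theorem smul_stdVec_mem_spaceGrid_one {d : ℕ} (h : ℝ) (i : Fin d) :
    h • stdVec i ∈ spaceGrid d h := by
  simpa using smul_stdVec_mem_spaceGrid h 1 i

/-- A nonzero grid vector has a coordinate of modulus at least `h`. Errors of order `h ‖X k - x₀‖`
can therefore be charged to the second moment. -/
theorem mul_norm_le_of_mem_spaceGrid {d : ℕ} {h : ℝ} (hh : 0 ≤ h) {x : Eu d}
    (hx : x ∈ spaceGrid d h) : h * ‖x‖ ≤ ‖x‖ ^ 2 := by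
  rcases eq_or_ne x 0 with rfl | hne
  · simp
  have : h ≤ ‖x‖ := by
    obtain ⟨z, hz⟩ := hx
    obtain ⟨i, hi⟩ : ∃ i, x i ≠ 0 := by
      by_contra! hall
      exact hne (by ext i; simpa using hall i)
    have hzi : z i ≠ 0 := by
      rintro h0
      exact hi (by rw [hz i, h0]; simp)
    have h1 : (1 : ℝ) ≤ |(z i : ℝ)| := by exact_mod_cast Int.one_le_abs hzi
    calc h ≤ h * |(z i : ℝ)| := le_mul_of_one_le_right hh h1
      _ = |x i| := by rw [hz i, abs_mul, abs_of_nonneg hh]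
      _ ≤ ‖x‖ := by simpa using PiLp.norm_apply_le x i
  rw [sq]
  exact mul_le_mul_of_nonneg_right this (norm_nonneg _)

/-- The regularised norm `√(κ² + |x|²)` lies below its tangent paraboloids. -/
theorem sqrt_sq_add_norm_sq_add_le {d : ℕ} {κ : ℝ} (hκ : 0 < κ) (x y : Eu d) :
    √(κ ^ 2 + ‖x + y‖ ^ 2) ≤ √(κ ^ 2 + ‖x‖ ^ 2) +
      (2 * inner ℝ x y + ‖y‖ ^ 2) / (2 * √(κ ^ 2 + ‖x‖ ^ 2)) := by
  set s := √(κ ^ 2 + ‖x‖ ^ 2) with hs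
  have hs0 : 0 < s := Real.sqrt_pos.2 (by positivity)
  have hs2 : s ^ 2 = κ ^ 2 + ‖x‖ ^ 2 := Real.sq_sqrt (by positivity)
  set t := √(κ ^ 2 + ‖x + y‖ ^ 2) with ht
  have ht2 : t ^ 2 = κ ^ 2 + ‖x + y‖ ^ 2 := Real.sq_sqrt (by positivity)
  have h1 := norm_add_sq_real x y
  rw [← sub_le_iff_le_add', le_div_iff₀ (by positivity)]
  nlinarith [sq_nonneg (t - s)]

theorem sq_sum_mul_le {ι : Type} [Fintype ι] {p u : ι → ℝ} (hp : ∀ k, 0 ≤ p k)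
    (hp1 : ∑ k, p k = 1) : (∑ k, p k * u k) ^ 2 ≤ ∑ k, p k * u k ^ 2 := by
  have := Finset.sum_sq_le_sum_mul_sum_of_sq_le_mul Finset.univ (r := fun k => p k * u k)
    (f := p) (g := fun k => p k * u k ^ 2) (fun k _ => hp k)
    (fun k _ => mul_nonneg (hp k) (sq_nonneg _)) (fun k _ => le_of_eq (by ring))
  rwa [hp1, one_mul] at this

section
variable {d : ℕ} {h A B κ : ℝ} {V : Eu d → ℝ} {ι : Type} [Fintype ι] {p : ι → ℝ}
  {X : ι → Eu d} {x₀ : Eu d}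

/-- The contribution of a jump of the base point by `y`, when the other points jump by `y` or
by `-y`. -/
theorem GridJensen.jump_le (hV : GridJensen h A B κ V) (hB : 0 ≤ B) (hκ : 0 < κ)
    (hp : ∀ k, 0 ≤ p k) (hp1 : ∑ k, p k = 1) (hX : ∀ k, X k ∈ spaceGrid d h)
    (hx₀ : x₀ ∈ spaceGrid d h) {y : Eu d} (hy : y ∈ spaceGrid d h) {r : ℝ} {u w : ι → ℝ}
    (hr : 0 ≤ r) (hu : ∀ k, 0 ≤ u k) (hur : ∀ k, u k ≤ r) (hw : ∀ k, 0 ≤ w k)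
    (huw : ∀ k, u k ^ 2 ≤ r * w k) :
    ∑ k, p k * ((r - u k) * V (X k + y) + u k * V (X k - y)) - r * V (x₀ + y) ≤
      r * (A * ∑ k, p k * ‖X k - x₀‖ ^ 2 + B * √(κ ^ 2 + ‖∑ k, p k • (X k - x₀)‖ ^ 2)) +
      A * ∑ k, p k * (u k * (4 * ‖y‖ ^ 2 - 4 * inner ℝ y (X k - x₀))) +
      B * (-2 * (∑ k, p k * u k) * inner ℝ (∑ k, p k • (X k - x₀)) y /
          √(κ ^ 2 + ‖∑ k, p k • (X k - x₀)‖ ^ 2) +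
        2 * ‖y‖ ^ 2 * (∑ k, p k * w k) / κ) := by
  set E := ∑ k, p k • (X k - x₀) with hE
  set S := ∑ k, p k * ‖X k - x₀‖ ^ 2 with hS
  set U := ∑ k, p k * u k with hU
  set W := ∑ k, p k * w k with hW
  have hW0 : 0 ≤ W := Finset.sum_nonneg fun k _ => mul_nonneg (hp k) (hw k)
  rcases hr.eq_or_lt with hr0 | hr0
  · have hu0 : ∀ k, u k = 0 := fun k => le_antisymm (by rw [hr0]; exact hur k) (hu k)
    have : 0 ≤ B * (2 * ‖y‖ ^ 2 * W / κ) := by positivity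
    simpa [← hr0, hu0, hU] using this
  set ψ := √(κ ^ 2 + ‖E‖ ^ 2) with hψ
  have hψκ : κ ≤ ψ := Real.le_sqrt_of_sq_le (by nlinarith [sq_nonneg ‖E‖])
  have hψ0 : 0 < ψ := hκ.trans_le hψκ
  -- The coupled law around `x₀ + y`: point `k` follows the jump with probability `1 - u k / r` and
  -- takes the opposite one with probability `u k / r`. In the first case its displacement from the
  -- base point is unchanged, in the second it moves by `-2y`.
  have key := hV (ι × Bool) (fun q => if q.2 then p q.1 * (1 - u q.1 / r) else p q.1 * (u q.1 / r))
    (fun q => if q.2 then X q.1 + y else X q.1 - y) (x₀ + y)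
    (by
      rintro ⟨k, b⟩
      cases b
      · exact mul_nonneg (hp k) (div_nonneg (hu k) hr)
      · exact mul_nonneg (hp k) (by rw [sub_nonneg, div_le_one hr0]; exact hur k))
    (by
      rw [Fintype.sum_prod_type]
      simp only [Fintype.sum_bool, if_true, Bool.false_eq_true, if_false]
      exact (Finset.sum_congr rfl fun k _ => by ring).trans hp1)
    (by
      rintro ⟨k, b⟩
      cases b
      · exact spaceGrid_sub (hX k) hy
      · exact spaceGrid_add (hX k) hy)
    (spaceGrid_add hx₀ hy)
  simp only [Fintype.sum_prod_type, Fintype.sum_bool, if_true, Bool.false_eq_true, if_false,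
    add_sub_add_right_eq_sub] at key
  have e1 : ∑ k, (p k * (1 - u k / r) * V (X k + y) + p k * (u k / r) * V (X k - y)) =
      (∑ k, p k * ((r - u k) * V (X k + y) + u k * V (X k - y))) / r := by
    rw [Finset.sum_div]
    exact Finset.sum_congr rfl fun k _ => by field_simp
  have e2 : ∑ k, (p k * (1 - u k / r) * ‖X k - x₀‖ ^ 2 +
      p k * (u k / r) * ‖X k - y - (x₀ + y)‖ ^ 2) =
      S + (∑ k, p k * (u k * (4 * ‖y‖ ^ 2 - 4 * inner ℝ y (X k - x₀)))) / r := by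
    rw [hS, Finset.sum_div, ← Finset.sum_add_distrib]
    refine Finset.sum_congr rfl fun k _ => ?_
    have : ‖X k - y - (x₀ + y)‖ ^ 2 =
        ‖X k - x₀‖ ^ 2 + (4 * ‖y‖ ^ 2 - 4 * inner ℝ y (X k - x₀)) := by
      have e : X k - y - (x₀ + y) = (X k - x₀) - (2 : ℝ) • y := by module
      rw [e, norm_sub_sq_real, inner_smul_right, norm_smul, real_inner_comm y]
      simp
      ring
    rw [this]
    field_simp
    ring
  have e3 : ∑ k, ((p k * (1 - u k / r)) • (X k - x₀) +
      (p k * (u k / r)) • (X k - y - (x₀ + y))) = E + (-2 * (U / r)) • y := by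
    have : ∀ k, (p k * (1 - u k / r)) • (X k - x₀) + (p k * (u k / r)) • (X k - y - (x₀ + y)) =
        p k • (X k - x₀) + (p k * u k * (-2 / r)) • y := fun k => by module
    simp only [this]
    rw [Finset.sum_add_distrib, ← Finset.sum_smul, ← Finset.sum_mul, ← hE, ← hU]
    congr 2
    ring
  rw [e1, e2, e3] at key
  have h4 := sqrt_sq_add_norm_sq_add_le hκ E ((-2 * (U / r)) • y)
  rw [← hψ, inner_smul_right, norm_smul, mul_pow, Real.norm_eq_abs, sq_abs] at h4
  have hU2 : U ^ 2 ≤ r * W := by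
    refine (sq_sum_mul_le hp hp1).trans ?_
    rw [hW, Finset.mul_sum]
    refine Finset.sum_le_sum fun k _ => ?_
    nlinarith [mul_le_mul_of_nonneg_left (huw k) (hp k)]
  -- Only one factor `1 / r` may remain, since the inequality is finally multiplied by `r`, which
  -- can be arbitrarily small. This is why `huw` is required.
  have h5 : (U / r) ^ 2 ≤ W / r := by
    rw [div_pow, div_le_div_iff₀ (by positivity) hr0]
    nlinarith
  have h6 : (2 * (-2 * (U / r) * inner ℝ E y) + (-2 * (U / r)) ^ 2 * ‖y‖ ^ 2) / (2 * ψ) ≤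
      (-2 * U * inner ℝ E y / ψ + 2 * ‖y‖ ^ 2 * W / κ) / r := by
    have e : (2 * (-2 * (U / r) * inner ℝ E y) + (-2 * (U / r)) ^ 2 * ‖y‖ ^ 2) / (2 * ψ) =
      (-2 * U * inner ℝ E y / ψ) / r + 2 * ‖y‖ ^ 2 * (U / r) ^ 2 / ψ := by
      field_simp
    rw [e, add_div]
    refine add_le_add le_rfl ?_
    calc 2 * ‖y‖ ^ 2 * (U / r) ^ 2 / ψ ≤ 2 * ‖y‖ ^ 2 * (W / r) / κ := by gcongr
      _ = _ := by ring
  have h7 := mul_le_mul_of_nonneg_left (h4.trans (add_le_add le_rfl h6)) hB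
  have h8 := key.trans (add_le_add le_rfl h7)
  have h9 := mul_le_mul_of_nonneg_left h8 hr
  have e4 : r * ((∑ k, p k * ((r - u k) * V (X k + y) + u k * V (X k - y))) / r - V (x₀ + y)) =
      ∑ k, p k * ((r - u k) * V (X k + y) + u k * V (X k - y)) - r * V (x₀ + y) := by
    field_simp
  rw [e4] at h9
  refine h9.trans (le_of_eq ?_)
  generalize ∑ k, p k * (u k * (4 * ‖y‖ ^ 2 - 4 * inner ℝ y (X k - x₀))) = Q
  field_simp
  ring

end

/-! ### One step of the monotone scheme -/

/-- Jump rates derived from a nonnegative semi-concave function. -/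
theorem rate_bounds {d : ℕ} {C ρ : ℝ} {φ : Eu d → ℝ} (hφ : SemiconcaveWith C φ) (hC : 0 ≤ C)
    (hρ : 0 ≤ ρ) (hc : Continuous φ) (h0 : ∀ x, 0 ≤ φ x) (x₀ x : Eu d) :
    0 ≤ ρ * max (φ x₀ - φ x) 0 ∧ ρ * max (φ x₀ - φ x) 0 ≤ ρ * φ x₀ ∧
      (ρ * max (φ x₀ - φ x) 0) ^ 2 ≤ ρ * φ x₀ * (2 * ρ * C * ‖x - x₀‖ ^ 2) := by
  refine ⟨mul_nonneg hρ (le_max_right _ _), mul_le_mul_of_nonneg_left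
    (max_le (by linarith [h0 x]) (h0 x₀)) hρ, ?_⟩
  have := mul_le_mul_of_nonneg_left (hφ.sq_decrease_le hC hc h0 x₀ x) (sq_nonneg ρ)
  rw [mul_pow]
  linarith

theorem continuous_of_abs_sub_le {d : ℕ} {K : ℝ} {g : Eu d → ℝ}
    (hL : ∀ x y, |g x - g y| ≤ K * ‖x - y‖) : Continuous g := by
  refine (LipschitzWith.of_dist_le_mul (K := K.toNNReal) fun x y => ?_).continuous
  rw [Real.dist_eq, dist_eq_norm]
  exact (hL x y).trans (mul_le_mul_of_nonneg_right (Real.le_coe_toNNReal K) (norm_nonneg _))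

theorem abs_apply_le_norm {d : ℕ} (x : Eu d) (i : Fin d) : |x i| ≤ ‖x‖ := by
  simpa using PiLp.norm_apply_le x i

theorem norm_smul_stdVec {d : ℕ} {h : ℝ} (hh : 0 ≤ h) (i : Fin d) :
    ‖h • (stdVec i : Eu d)‖ = h := by
  simp [norm_smul, stdVec, abs_of_nonneg hh]

theorem inner_smul_stdVec {d : ℕ} (h : ℝ) (i : Fin d) (x : Eu d) :
    inner ℝ (h • (stdVec i : Eu d)) x = h * x i := by
  rw [real_inner_smul_left]
  simp [stdVec, EuclideanSpace.inner_single_left]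

/-- The averaging operator of the monotone scheme with drift `b`. -/
noncomputable def schemeAvg {d : ℕ} (h τ N : ℝ) (b : Eu d) (V : Eu d → ℝ) (x : Eu d) : ℝ :=
  (1 - 2 * d * N * τ / h) * V x + ∑ i, (τ / (2 * h) * (2 * N + b i) * V (x + h • stdVec i) +
    τ / (2 * h) * (2 * N - b i) * V (x - h • stdVec i))

/-- With frozen control the scheme is a weighted mean: the artificial viscosity `N h Δʰ` contributes
`2N` to both weights in each direction, the drift `± b i`. The weights are nonnegative exactly under
the CFL condition and `|b i| ≤ 2N`. -/
theorem scheme_eq_schemeAvg {d : ℕ} {h : ℝ} (hh : 0 < h) (τ N c : ℝ) (b : Eu d) (V : Eu d → ℝ)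
    (x : Eu d) : V x + τ * (c + inner ℝ (gradH h V x) b) + τ * (N * h * laplH h V x) =
      τ * c + schemeAvg h τ N b V x := by
  have e1 : inner ℝ (gradH h V x) b =
      ∑ i, (V (x + h • stdVec i) - V (x - h • stdVec i)) / (2 * h) * b i := by
    simp [gradH, PiLp.inner_apply, mul_comm]
  have e2 : (1 - 2 * d * N * τ / h) * V x = V x - ∑ _i : Fin d, 2 * N * τ / h * V x := by
    simp; ring
  rw [schemeAvg, e1, laplH, e2, mul_add, Finset.mul_sum, Finset.mul_sum, Finset.mul_sum]
  have e3 : ∑ i, (τ / (2 * h) * (2 * N + b i) * V (x + h • stdVec i) +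
        τ / (2 * h) * (2 * N - b i) * V (x - h • stdVec i)) =
      ∑ i, τ * ((V (x + h • stdVec i) - V (x - h • stdVec i)) / (2 * h) * b i) +
      ∑ i, τ * (N * h * ((V (x + h • stdVec i) - 2 * V x + V (x - h • stdVec i)) / h ^ 2)) +
      ∑ _i : Fin d, 2 * N * τ / h * V x := by
    rw [← Finset.sum_add_distrib, ← Finset.sum_add_distrib]
    refine Finset.sum_congr rfl fun i _ => ?_
    field_simp
    ring
  rw [e3]
  ring

section
variable {d : ℕ} {h τ A B κ K C N : ℝ} {V : Eu d → ℝ} {ι : Type} [Fintype ι] {p : ι → ℝ}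
  {X : ι → Eu d} {x₀ : Eu d}

/-- The rates along `e_i` and `-e_i` have the same sum at every point, so whatever `X k` loses in
one direction relative to `x₀` it gains in the other. Reversing the excess jumps thus reproduces the
rates at `X k`, and `GridJensen.jump_le` applies to both directions. Their first-order effects on
the mean combine into the difference of drifts. -/
theorem GridJensen.coord_le (hV : GridJensen h A B κ V) (hA : 0 ≤ A) (hB : 0 ≤ B) (hκ : 0 < κ)
    (hh : 0 < h) (hτ : 0 < τ) (hK : 0 ≤ K) (hC : 0 ≤ C)
    (hp : ∀ k, 0 ≤ p k) (hp1 : ∑ k, p k = 1) (hX : ∀ k, X k ∈ spaceGrid d h)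
    (hx₀ : x₀ ∈ spaceGrid d h) {β : Eu d → ℝ} (hN : ∀ x, |β x| ≤ 2 * N)
    (hL : ∀ x y, |β x - β y| ≤ K * ‖x - y‖) (hs : SemiconcaveWith C β)
    (hs' : SemiconcaveWith C (fun x => -β x)) (i : Fin d) :
    ∑ k, p k * (τ / (2 * h) * (2 * N + β (X k)) * V (X k + h • stdVec i) +
        τ / (2 * h) * (2 * N - β (X k)) * V (X k - h • stdVec i)) -
      (τ / (2 * h) * (2 * N + β x₀) * V (x₀ + h • stdVec i) +
        τ / (2 * h) * (2 * N - β x₀) * V (x₀ - h • stdVec i)) ≤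
      2 * N * τ / h * (A * ∑ k, p k * ‖X k - x₀‖ ^ 2 +
          B * √(κ ^ 2 + ‖∑ k, p k • (X k - x₀)‖ ^ 2)) +
        τ * (4 * A * K * ∑ k, p k * ‖X k - x₀‖ ^ 2 +
          B * (K * √(κ ^ 2 + ‖∑ k, p k • (X k - x₀)‖ ^ 2) +
            C * (1 + 4 * (h / κ)) * ∑ k, p k * ‖X k - x₀‖ ^ 2)) := by
  have hc := continuous_of_abs_sub_le hL
  set ρ := τ / (2 * h) with hρ
  have hρ0 : 0 < ρ := by positivity
  set y : Eu d := h • stdVec i with hy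
  have hyg : y ∈ spaceGrid d h := smul_stdVec_mem_spaceGrid_one h i
  have hyn : ‖y‖ = h := norm_smul_stdVec hh.le i
  have hyi : ∀ x : Eu d, inner ℝ y x = h * x i := fun x => inner_smul_stdVec h i x
  have hsp : SemiconcaveWith C (fun x => 2 * N + β x) := fun x z => by
    have := hs x z
    simp only
    linarith
  have hsm : SemiconcaveWith C (fun x => 2 * N - β x) := fun x z => by
    have := hs' x z
    simp only at this ⊢
    linarith
  have hbp : ∀ x, 0 ≤ 2 * N + β x := fun x => by linarith [neg_le_of_abs_le (hN x)]
  have hbm : ∀ x, 0 ≤ 2 * N - β x := fun x => by linarith [le_of_abs_le (hN x)]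
  have rp := fun k => rate_bounds hsp hC hρ0.le (by fun_prop) hbp x₀ (X k)
  have rm := fun k => rate_bounds hsm hC hρ0.le (by fun_prop) hbm x₀ (X k)
  have Jp := hV.jump_le hB hκ hp hp1 hX hx₀ hyg (mul_nonneg hρ0.le (hbp x₀)) (fun k => (rp k).1)
    (fun k => (rp k).2.1) (fun k => by positivity) (fun k => (rp k).2.2)
  have Jm := hV.jump_le hB hκ hp hp1 hX hx₀ (spaceGrid_neg hyg) (mul_nonneg hρ0.le (hbm x₀))
    (fun k => (rm k).1) (fun k => (rm k).2.1) (fun k => by positivity) (fun k => (rm k).2.2)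
  simp only [sub_neg_eq_add, ← sub_eq_add_neg, norm_neg, inner_neg_left, inner_neg_right, hyn]
    at Jp Jm
  set E := ∑ k, p k • (X k - x₀) with hE
  rw [real_inner_comm, hyi] at Jp Jm
  simp only [hyi] at Jp Jm
  set S := ∑ k, p k * ‖X k - x₀‖ ^ 2 with hS
  set ψ := √(κ ^ 2 + ‖E‖ ^ 2) with hψ
  have hψE : ‖E‖ ≤ ψ := Real.le_sqrt_of_sq_le (by nlinarith [sq_nonneg κ])
  have hψκ : κ ≤ ψ := Real.le_sqrt_of_sq_le (by nlinarith [sq_nonneg ‖E‖])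
  have hψ0 : 0 < ψ := hκ.trans_le hψκ
  have hS0 : 0 ≤ S := Finset.sum_nonneg fun k _ => mul_nonneg (hp k) (sq_nonneg _)
  set up : ι → ℝ := fun k => ρ * max (2 * N + β x₀ - (2 * N + β (X k))) 0 with hup
  set um : ι → ℝ := fun k => ρ * max (2 * N - β x₀ - (2 * N - β (X k))) 0 with hum
  have hdiff : ∀ k, um k - up k = ρ * (β (X k) - β x₀) := by
    intro k
    simp only [hup, hum, ← mul_sub]
    rcases le_total (β (X k)) (β x₀) with h1 | h1
    · rw [max_eq_right (by linarith), max_eq_left (by linarith)]; ring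
    · rw [max_eq_left (by linarith), max_eq_right (by linarith)]; ring
  have hsum : ∀ k, up k + um k = ρ * |β (X k) - β x₀| := by
    intro k
    simp only [hup, hum, ← mul_add]
    rcases le_total (β (X k)) (β x₀) with h1 | h1
    · rw [max_eq_left (by linarith), max_eq_right (by linarith), abs_of_nonpos (by linarith)]; ring
    · rw [max_eq_right (by linarith), max_eq_left (by linarith), abs_of_nonneg (by linarith)]; ring
  have eV : ∑ k, p k * (ρ * (2 * N + β (X k)) * V (X k + y) +
      ρ * (2 * N - β (X k)) * V (X k - y)) =
      ∑ k, p k * ((ρ * (2 * N + β x₀) - up k) * V (X k + y) + up k * V (X k - y)) +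
      ∑ k, p k * ((ρ * (2 * N - β x₀) - um k) * V (X k - y) + um k * V (X k + y)) := by
    rw [← Finset.sum_add_distrib]
    refine Finset.sum_congr rfl fun k _ => ?_
    have := hdiff k
    linear_combination (p k * V (X k - y) - p k * V (X k + y)) * this
  have eA : ∑ k, p k * (up k * (4 * h ^ 2 - 4 * (h * (X k - x₀) i))) +
      ∑ k, p k * (um k * (4 * h ^ 2 - 4 * -(h * (X k - x₀) i))) ≤ 4 * τ * K * S := by
    rw [← Finset.sum_add_distrib, hS, Finset.mul_sum]
    refine Finset.sum_le_sum fun k _ => ?_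
    have hD := spaceGrid_sub (hX k) hx₀
    have h1 := mul_norm_le_of_mem_spaceGrid hh.le hD
    have h2 := hL (X k) x₀
    have h3 := abs_apply_le_norm (X k - x₀) i
    have e : p k * (up k * (4 * h ^ 2 - 4 * (h * (X k - x₀) i))) +
        p k * (um k * (4 * h ^ 2 - 4 * -(h * (X k - x₀) i))) =
        p k * (2 * τ * (h * |β (X k) - β x₀| + (β (X k) - β x₀) * (X k - x₀) i)) := by
      have h4 : ρ * (2 * h) = τ := by rw [hρ]; field_simp
      linear_combination (p k * 4 * h ^ 2) * hsum k + (p k * 4 * h * (X k - x₀) i) * hdiff k +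
        (p k * (2 * h) * |β (X k) - β x₀| + 2 * p k * (β (X k) - β x₀) * (X k - x₀) i) * h4
    rw [e]
    have h5 : h * |β (X k) - β x₀| ≤ K * ‖X k - x₀‖ ^ 2 := by
      calc h * |β (X k) - β x₀| ≤ h * (K * ‖X k - x₀‖) := mul_le_mul_of_nonneg_left h2 hh.le
        _ = K * (h * ‖X k - x₀‖) := by ring
        _ ≤ _ := mul_le_mul_of_nonneg_left h1 hK
    have h6 : (β (X k) - β x₀) * (X k - x₀) i ≤ K * ‖X k - x₀‖ ^ 2 := by
      calc (β (X k) - β x₀) * (X k - x₀) i ≤ |β (X k) - β x₀| * |(X k - x₀) i| := by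
            rw [← abs_mul]; exact le_abs_self _
        _ ≤ (K * ‖X k - x₀‖) * ‖X k - x₀‖ := by gcongr
        _ = _ := by ring
    calc p k * (2 * τ * (h * |β (X k) - β x₀| + (β (X k) - β x₀) * (X k - x₀) i))
        ≤ p k * (2 * τ * (K * ‖X k - x₀‖ ^ 2 + K * ‖X k - x₀‖ ^ 2)) :=
          mul_le_mul_of_nonneg_left (mul_le_mul_of_nonneg_left (add_le_add h5 h6)
            (by positivity)) (hp k)
      _ = _ := by ring
  have eB : -2 * (∑ k, p k * up k) * (h * E i) / ψ + -2 * (∑ k, p k * um k) * -(h * E i) / ψ ≤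
      τ * (K * ψ + C * S) := by
    have h4 : ρ * (2 * h) = τ := by rw [hρ]; field_simp
    set Q := ∑ k, p k * β (X k) - β x₀ with hQ
    have e1 : ∑ k, p k * um k - ∑ k, p k * up k = ρ * Q := by
      rw [← Finset.sum_sub_distrib, hQ]
      have : ∀ k, p k * um k - p k * up k = ρ * (p k * β (X k)) - ρ * β x₀ * p k := fun k => by
        linear_combination p k * hdiff k
      simp only [this, Finset.sum_sub_distrib, ← Finset.mul_sum, hp1]
      ring
    have e2 : -2 * (∑ k, p k * up k) * (h * E i) / ψ + -2 * (∑ k, p k * um k) * -(h * E i) / ψ =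
        τ * (E i * Q / ψ) := by
      field_simp
      linear_combination (2 * h * E i) * e1 + E i * Q * h4
    rw [e2]
    -- Semi-concavity of `β` and of `-β` bounds `|Q|` by the displacement of the mean plus the
    -- second moment. The Lipschitz bound alone would leave the first moment `∑ p k ‖X k - x₀‖`.
    have hQ1 := hs.sum_sub_le hC hL hp hp1 X x₀
    have hQ2 := hs'.sum_sub_le hC (K := K) (fun x z => by
      rw [← abs_neg]; simpa [neg_sub, sub_eq_add_neg, add_comm] using hL x z) hp hp1 X x₀
    simp only [mul_neg, Finset.sum_neg_distrib, sub_neg_eq_add] at hQ2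
    have hQa : |Q| ≤ K * ψ + C * S := by
      have : K * ‖E‖ ≤ K * ψ := mul_le_mul_of_nonneg_left hψE hK
      rw [abs_le]
      constructor <;> linarith
    have h7 : E i * Q / ψ ≤ |Q| := by
      rw [div_le_iff₀ hψ0]
      calc E i * Q ≤ |E i| * |Q| := by rw [← abs_mul]; exact le_abs_self _
        _ ≤ ψ * |Q| := mul_le_mul_of_nonneg_right ((abs_apply_le_norm E i).trans hψE)
          (abs_nonneg _)
        _ = _ := mul_comm _ _
    exact mul_le_mul_of_nonneg_left (h7.trans hQa) hτ.le
  have eW : ∑ k, p k * (2 * ρ * C * ‖X k - x₀‖ ^ 2) = τ / h * C * S := by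
    rw [hS, Finset.mul_sum]
    refine Finset.sum_congr rfl fun k _ => ?_
    rw [hρ]
    field_simp
  rw [eW] at Jp Jm
  rw [eV]
  have hfin := add_le_add Jp Jm
  have hA' := mul_le_mul_of_nonneg_left eA hA
  have hB' := mul_le_mul_of_nonneg_left eB hB
  have hr : ρ * (2 * N + β x₀) + ρ * (2 * N - β x₀) = 2 * N * τ / h := by
    rw [hρ]; field_simp; ring
  -- Rates of order `τ / h` and squared jumps of order `h²`, divided by the regularisation `κ`.
  have hnoise : 2 * h ^ 2 * (τ / h * C * S) / κ = τ * (2 * C * (h / κ) * S) := by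
    field_simp
  rw [hnoise] at hfin
  have e5 : ρ * (2 * N + β x₀) * (A * S + B * ψ) + ρ * (2 * N - β x₀) * (A * S + B * ψ) =
      2 * N * τ / h * (A * S + B * ψ) := by rw [← add_mul, hr]
  linarith

/-- One-step propagation of the approximate Jensen inequality through the monotone scheme. -/
theorem GridJensen.step (hV : GridJensen h A B κ V) (hA : 0 ≤ A) (hB : 0 ≤ B) (hκ : 0 < κ)
    (hh : 0 < h) (hτ : 0 < τ) (hcfl : 2 * d * N * τ ≤ h) (hK : 0 ≤ K) (hC : 0 ≤ C)
    (hp : ∀ k, 0 ≤ p k) (hp1 : ∑ k, p k = 1) (hX : ∀ k, X k ∈ spaceGrid d h)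
    (hx₀ : x₀ ∈ spaceGrid d h) {V' : Eu d → ℝ} {c : Eu d → ℝ} {b : Eu d → Eu d}
    (hN : ∀ x, ‖b x‖ ≤ 2 * N) (hcL : ∀ x y, |c x - c y| ≤ K * ‖x - y‖)
    (hbL : ∀ x y, ‖b x - b y‖ ≤ K * ‖x - y‖) (hcs : SemiconcaveWith C c)
    (hbs : ∀ i, SemiconcaveWith C (fun x => b x i))
    (hbs' : ∀ i, SemiconcaveWith C (fun x => -b x i))
    (hle : ∀ x ∈ spaceGrid d h,
      V' x ≤ V x + τ * (c x + inner ℝ (gradH h V x) (b x)) + τ * (N * h * laplH h V x))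
    (heq : V' x₀ = V x₀ + τ * (c x₀ + inner ℝ (gradH h V x₀) (b x₀)) +
      τ * (N * h * laplH h V x₀)) :
    ∑ k, p k * V' (X k) - V' x₀ ≤
      (A + τ * (4 * d * K * A + C + d * (B * (C * (1 + 4 * (h / κ)))))) *
        ∑ k, p k * ‖X k - x₀‖ ^ 2 +
      (B + τ * (d * K * B + K)) * √(κ ^ 2 + ‖∑ k, p k • (X k - x₀)‖ ^ 2) := by
  have hform : ∀ x, V x + τ * (c x + inner ℝ (gradH h V x) (b x)) + τ * (N * h * laplH h V x) =
      τ * c x + (1 - 2 * d * N * τ / h) * V x +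
        ∑ i, (τ / (2 * h) * (2 * N + b x i) * V (x + h • stdVec i) +
          τ / (2 * h) * (2 * N - b x i) * V (x - h • stdVec i)) := by
    intro x
    rw [scheme_eq_schemeAvg hh, schemeAvg, add_assoc]
  set E := ∑ k, p k • (X k - x₀) with hE
  set S := ∑ k, p k * ‖X k - x₀‖ ^ 2 with hS
  set ψ := √(κ ^ 2 + ‖E‖ ^ 2) with hψ
  have hψE : ‖E‖ ≤ ψ := Real.le_sqrt_of_sq_le (by nlinarith [sq_nonneg κ])
  have hup : ∑ k, p k * V' (X k) ≤ ∑ k, p k * (τ * c (X k) + (1 - 2 * d * N * τ / h) * V (X k) +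
        ∑ i, (τ / (2 * h) * (2 * N + b (X k) i) * V (X k + h • stdVec i) +
          τ / (2 * h) * (2 * N - b (X k) i) * V (X k - h • stdVec i))) :=
    Finset.sum_le_sum fun k _ => mul_le_mul_of_nonneg_left
      ((hle _ (hX k)).trans (le_of_eq (hform _))) (hp k)
  have hsplit : ∑ k, p k * (τ * c (X k) + (1 - 2 * d * N * τ / h) * V (X k) +
        ∑ i, (τ / (2 * h) * (2 * N + b (X k) i) * V (X k + h • stdVec i) +
          τ / (2 * h) * (2 * N - b (X k) i) * V (X k - h • stdVec i))) =
      τ * ∑ k, p k * c (X k) + (1 - 2 * d * N * τ / h) * ∑ k, p k * V (X k) +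
      ∑ i, ∑ k, p k * (τ / (2 * h) * (2 * N + b (X k) i) * V (X k + h • stdVec i) +
          τ / (2 * h) * (2 * N - b (X k) i) * V (X k - h • stdVec i)) := by
    rw [Finset.sum_comm, Finset.mul_sum, Finset.mul_sum, ← Finset.sum_add_distrib,
      ← Finset.sum_add_distrib]
    refine Finset.sum_congr rfl fun k _ => ?_
    rw [← Finset.mul_sum]
    ring
  have hcoord : ∀ i : Fin d, _ := fun i => hV.coord_le hA hB hκ hh hτ hK hC hp hp1 hX hx₀
    (β := fun x => b x i) (N := N) (fun x => (abs_apply_le_norm (b x) i).trans (hN x))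
    (fun x y => (abs_apply_le_norm (b x - b y) i).trans (hbL x y)) (hbs i) (hbs' i) i
  have hsum := Finset.sum_le_sum fun i (_ : i ∈ Finset.univ) => hcoord i
  rw [Finset.sum_sub_distrib, Finset.sum_const, Finset.card_univ, Fintype.card_fin,
    nsmul_eq_mul, ← hE, ← hS, ← hψ] at hsum
  have hcost := hcs.sum_sub_le hC hcL hp hp1 X x₀
  rw [← hE, ← hS] at hcost
  have hcost' := mul_le_mul_of_nonneg_left
    (hcost.trans (add_le_add (mul_le_mul_of_nonneg_left hψE hK) le_rfl)) hτ.le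
  have hstay : 0 ≤ 1 - 2 * d * N * τ / h := by
    rw [sub_nonneg, div_le_one hh]
    exact hcfl
  have h0 := mul_le_mul_of_nonneg_left (hV ι p X x₀ hp hp1 hX hx₀) hstay
  rw [← hE, ← hS, ← hψ] at h0
  rw [hsplit] at hup
  rw [heq, hform]
  have e6 : (d : ℝ) * (2 * N * τ / h * (A * S + B * ψ)) =
    2 * d * N * τ / h * (A * S + B * ψ) := by ring
  linarith

end

/-! ### Uniform Jensen inequality for the scheme -/

/-- Quantitative form of the standing assumptions: `K` bounds the data and their Lipschitz
constants, `C` is a constant of semi-concavity of `q`, `c(t,·,a)` and `± f(t,·,a)`. -/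
structure ControlData {d m : ℕ} (T N K C : ℝ) (A : Set (Eu m)) (c : ℝ → Eu d → Eu m → ℝ)
    (f : ℝ → Eu d → Eu m → Eu d) (q : Eu d → ℝ) (α : ℝ → Eu d → Eu d → Eu m) : Prop where
  K_nonneg : 0 ≤ K
  C_nonneg : 0 ≤ C
  argmin : IsArgminPolicy T A c f α
  f_bound : ∀ t ∈ Icc (0 : ℝ) T, ∀ x : Eu d, ∀ a ∈ A, ‖f t x a‖ ≤ K
  f_speed : ∀ t ∈ Icc (0 : ℝ) T, ∀ x : Eu d, ∀ a ∈ A, ‖f t x a‖ ≤ 2 * N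
  c_lip : ∀ t ∈ Icc (0 : ℝ) T, ∀ s ∈ Icc (0 : ℝ) T, ∀ x y : Eu d, ∀ a ∈ A,
    |c t x a - c s y a| ≤ K * (|t - s| + ‖x - y‖)
  f_lip : ∀ t ∈ Icc (0 : ℝ) T, ∀ s ∈ Icc (0 : ℝ) T, ∀ x y : Eu d, ∀ a ∈ A,
    ‖f t x a - f s y a‖ ≤ K * (|t - s| + ‖x - y‖)
  q_lip : ∀ x y : Eu d, |q x - q y| ≤ K * ‖x - y‖
  q_semi : SemiconcaveWith C q
  c_semi : ∀ t ∈ Icc (0 : ℝ) T, ∀ a ∈ A, SemiconcaveWith C (fun x => c t x a)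
  f_semi : ∀ t ∈ Icc (0 : ℝ) T, ∀ a ∈ A, ∀ i, SemiconcaveWith C (fun x => f t x a i)
  f_semi_neg : ∀ t ∈ Icc (0 : ℝ) T, ∀ a ∈ A, ∀ i, SemiconcaveWith C (fun x => -f t x a i)

theorem SemiconcaveWith.mono {d : ℕ} {C C' : ℝ} {g : Eu d → ℝ} (hg : SemiconcaveWith C g)
    (h : C ≤ C') : SemiconcaveWith C' g := fun x y =>
  (hg x y).trans (mul_le_mul_of_nonneg_right h (sq_nonneg _))

/-- The bounds in `W^{2,∞}` control second differences from both sides, hence semi-concavity of `f`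
and of `-f` alike. -/
theorem exists_controlData {d m : ℕ} {T N : ℝ} {A : Set (Eu m)} {c : ℝ → Eu d → Eu m → ℝ}
    {f : ℝ → Eu d → Eu m → Eu d} {q : Eu d → ℝ} {α : ℝ → Eu d → Eu d → Eu m}
    (hα : IsArgminPolicy T A c f α) (hdata : DataBoundedLipschitz T A c f q)
    (hsecond : DataSecondOrder T A c f q)
    (hNf : ∀ t ∈ Icc (0 : ℝ) T, ∀ x : Eu d, ∀ a ∈ A, ‖f t x a‖ / 2 ≤ N) :
    ∃ K C, ControlData T N K C A c f q α := by
  obtain ⟨K, hb, hq, hL, hqL⟩ := hdata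
  obtain ⟨⟨C₀, hC₀, hq_semi⟩, M, hM⟩ := hsecond
  have hL' : ∀ t ∈ Icc (0 : ℝ) T, ∀ s ∈ Icc (0 : ℝ) T, ∀ x y : Eu d, ∀ a ∈ A,
      |c t x a - c s y a| ≤ K * (|t - s| + ‖x - y‖) ∧
      ‖f t x a - f s y a‖ ≤ K * (|t - s| + ‖x - y‖) := by
    intro t ht s hs x y a ha
    simpa using hL t ht s hs x y a ha a ha
  have hcW : ∀ t ∈ Icc (0 : ℝ) T, ∀ a ∈ A, _ := fun t ht a ha =>
    (hM t ht a ha).1.semiconcaveWith (K := K) fun x y => by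
      simpa using (hL' t ht t ht x y a ha).1
  have hfW : ∀ t ∈ Icc (0 : ℝ) T, ∀ a ∈ A, ∀ i : Fin d, _ := fun t ht a ha i =>
    ((hM t ht a ha).2 i).semiconcaveWith (K := K) fun x y => by
      have := (abs_apply_le_norm (f t x a - f t y a) i).trans (hL' t ht t ht x y a ha).2
      simpa using this
  have hC1 : C₀ ≤ C₀ + 2 * (|M| * d ^ 2) := by
    have : 0 ≤ 2 * (|M| * d ^ 2) := by positivity
    linarith
  have hC2 : 2 * (|M| * d ^ 2) ≤ C₀ + 2 * (|M| * d ^ 2) := by linarith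
  exact ⟨K, C₀ + 2 * (|M| * d ^ 2), {
    K_nonneg := (abs_nonneg _).trans (hq 0)
    C_nonneg := hC₀.le.trans hC1
    argmin := hα
    f_bound := fun t ht x a ha => (hb t ht x a ha).2
    f_speed := fun t ht x a ha => by linarith [hNf t ht x a ha]
    c_lip := fun t ht s hs x y a ha => (hL' t ht s hs x y a ha).1
    f_lip := fun t ht s hs x y a ha => (hL' t ht s hs x y a ha).2
    q_lip := hqL
    q_semi := hq_semi.mono hC1
    c_semi := fun t ht a ha => (hcW t ht a ha).1.mono hC2
    f_semi := fun t ht a ha i => (hfW t ht a ha i).1.mono hC2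
    f_semi_neg := fun t ht a ha i => (hfW t ht a ha i).2.mono hC2 }⟩

section
variable {d m : ℕ} {T N K C : ℝ} {A : Set (Eu m)} {c : ℝ → Eu d → Eu m → ℝ}
  {f : ℝ → Eu d → Eu m → Eu d} {q : Eu d → ℝ} {α : ℝ → Eu d → Eu d → Eu m}

theorem ControlData.isLeast (D : ControlData T N K C A c f q α) {t : ℝ} (ht : t ∈ Icc 0 T)
    (x p : Eu d) : IsLeast ((fun a : Eu m => c t x a + inner ℝ p (f t x a)) '' A)
      (c t x (α t x p) + inner ℝ p (f t x (α t x p))) := by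
  obtain ⟨h1, h2⟩ := D.argmin t ht x p
  refine ⟨⟨_, h1, rfl⟩, ?_⟩
  rintro _ ⟨a, ha, rfl⟩
  by_cases h : a = α t x p
  · rw [h]
  · exact (h2 a ha h).le

theorem ControlData.hamiltonian_eq (D : ControlData T N K C A c f q α) {t : ℝ}
    (ht : t ∈ Icc 0 T) (x p : Eu d) :
    hamiltonian A c f t x p = c t x (α t x p) + inner ℝ p (f t x (α t x p)) :=
  (D.isLeast ht x p).csInf_eq

theorem ControlData.hamiltonian_le (D : ControlData T N K C A c f q α) {t : ℝ}
    (ht : t ∈ Icc 0 T) (x p : Eu d) {a : Eu m} (ha : a ∈ A) :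
    hamiltonian A c f t x p ≤ c t x a + inner ℝ p (f t x a) := by
  rw [D.hamiltonian_eq ht]
  exact (D.isLeast ht x p).2 ⟨a, ha, rfl⟩

theorem GridJensen.mono {h B B' A₁ A₂ κ : ℝ} {V : Eu d → ℝ} (hV : GridJensen h A₁ B κ V)
    (hA : A₁ ≤ A₂) (hB : B ≤ B') : GridJensen h A₂ B' κ V := by
  intro ι _ p X x₀ hp hp1 hX hx₀
  have hS : 0 ≤ ∑ k, p k * ‖X k - x₀‖ ^ 2 :=
    Finset.sum_nonneg fun k _ => mul_nonneg (hp k) (sq_nonneg _)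
  exact (hV ι p X x₀ hp hp1 hX hx₀).trans
    (add_le_add (mul_le_mul_of_nonneg_right hA hS)
      (mul_le_mul_of_nonneg_right hB (Real.sqrt_nonneg _)))

theorem IsGridSolution.step_eq {τ h : ℝ} {H : ℝ → Eu d → Eu d → ℝ} {V : ℝ → Eu d → ℝ}
    (hV : IsGridSolution T N τ h H q V) (hτ : 0 < τ) {t : ℝ} (ht : t ∈ timeGrid T τ)
    (ht0 : t ≠ 0) {x : Eu d} (hx : x ∈ spaceGrid d h) :
    V (t - τ) x = V t x + τ * H t x (gradH h (V t) x) + τ * (N * h * laplH h (V t) x) := by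
  have := hV.1 t ⟨ht, ht0⟩ x hx
  field_simp at this
  linarith

/-- Backward induction over the time grid. -/
theorem timeGrid_induction {τ : ℝ} {n : ℕ} (hτ : 0 < τ) (hn : T = n * τ) {P : ℕ → ℝ → Prop}
    (h0 : P 0 T)
    (hstep : ∀ (k : ℕ) (t : ℝ), t ∈ timeGrid T τ → t ≠ 0 → t ∈ Icc 0 T → t - τ ∈ Icc 0 T → T - t = k * τ →
      P k t → P (k + 1) (t - τ))
    {t : ℝ} (ht : t ∈ timeGrid T τ) : ∃ k : ℕ, (k : ℝ) * τ ≤ T ∧ P k t := by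
  have key : ∀ k : ℕ, k ≤ n → P k (T - k * τ) := by
    intro k
    induction k with
    | zero => intro _; simpa using h0
    | succ k ih =>
      intro hk
      have hk' : k + 1 ≤ n := hk
      have hkn : (k : ℝ) + 1 ≤ n := by exact_mod_cast hk'
      have h1 : τ ≤ T - k * τ := by rw [hn]; nlinarith
      have h2 : 0 ≤ k * τ := by positivity
      have := hstep k (T - k * τ) ⟨n - k, by
          rw [Nat.cast_sub (by omega), hn]; ring, by linarith⟩
        (by linarith) ⟨by linarith, by linarith⟩ ⟨by linarith, by linarith⟩ (by ring)
        (ih (by omega))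
      have e : T - k * τ - τ = T - ((k + 1 : ℕ) : ℝ) * τ := by push_cast; ring
      rwa [e] at this
  obtain ⟨j, hj, hjT⟩ := ht
  have hjn : j ≤ n := by
    rw [hj, hn] at hjT
    exact_mod_cast le_of_mul_le_mul_right hjT hτ
  have hjn' : (j : ℝ) ≤ n := by exact_mod_cast hjn
  have e : t = T - ((n - j : ℕ) : ℝ) * τ := by
    rw [Nat.cast_sub hjn, hj, hn]; ring
  refine ⟨n - j, ?_, ?_⟩
  · rw [Nat.cast_sub hjn, hn]
    have : 0 ≤ (j : ℝ) := Nat.cast_nonneg j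
    nlinarith
  · rw [e]
    exact key _ (Nat.sub_le _ _)

theorem one_add_mul_pow_le_exp {R τ : ℝ} (hR : 0 ≤ R) (hτ : 0 ≤ τ) {k : ℕ} (hk : k * τ ≤ T) :
    (1 + R * τ) ^ k ≤ Real.exp (R * T) := by
  have h1 : 1 + R * τ ≤ Real.exp (R * τ) := by
    have := Real.add_one_le_exp (R * τ)
    linarith
  calc (1 + R * τ) ^ k ≤ Real.exp (R * τ) ^ k := pow_le_pow_left₀ (by positivity) h1 k
    _ = Real.exp (k * (R * τ)) := (Real.exp_nat_mul _ _).symm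
    _ ≤ Real.exp (R * T) := Real.exp_le_exp.2 (by nlinarith)

/-- Uniform approximate Jensen inequality for the solutions of the scheme. -/
theorem ControlData.exists_gridJensen (D : ControlData T N K C A c f q α) :
    ∃ Γ : ℝ, 0 < Γ ∧ ∀ (τ h κ : ℝ) (n : ℕ) (V : ℝ → Eu d → ℝ), 0 < τ → 0 < h → 0 < κ →
      2 * d * N * τ ≤ h → T = n * τ → IsGridSolution T N τ h (hamiltonian A c f) q V →
      ∀ t ∈ timeGrid T τ, GridJensen h (Γ * (1 + h / κ)) Γ κ (V t) := by
  have hK := D.K_nonneg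
  have hC := D.C_nonneg
  -- `R` adds up the growth coefficients of one step. The constant `β` dominates the terminal
  -- constants `C` and `K`, and `β ≥ 1` lets the inhomogeneous terms of a step be absorbed into the
  -- multiplicative growth.
  set R : ℝ := 4 * d * K + C + 4 * d * C + d * K + K with hR
  have hR0 : 0 ≤ R := by positivity
  set β : ℝ := 1 + K + C with hβ
  have hβ1 : 1 ≤ β := by linarith
  refine ⟨β * Real.exp (R * T), by positivity, ?_⟩
  intro τ h κ n V hτ hh hκ hcfl hn hV t ht
  set l := 1 + h / κ with hl
  have hl1 : 1 ≤ l := by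
    have : 0 ≤ h / κ := by positivity
    linarith
  suffices ∃ k : ℕ, (k : ℝ) * τ ≤ T ∧
      GridJensen h (β * (1 + R * τ) ^ k * l) (β * (1 + R * τ) ^ k) κ (V t) by
    obtain ⟨k, hkT, hk⟩ := this
    have h1 : β * (1 + R * τ) ^ k ≤ β * Real.exp (R * T) :=
      mul_le_mul_of_nonneg_left (one_add_mul_pow_le_exp hR0 hτ.le hkT) (by linarith)
    exact hk.mono (mul_le_mul_of_nonneg_right h1 (by linarith)) h1
  refine timeGrid_induction (P := fun k t =>
      GridJensen h (β * (1 + R * τ) ^ k * l) (β * (1 + R * τ) ^ k) κ (V t)) hτ hn ?_ ?_ ht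
  · intro ι _ p X x₀ hp hp1 hX hx₀
    have h1 := D.q_semi.sum_sub_le hC D.q_lip hp hp1 X x₀
    have hS : 0 ≤ ∑ k, p k * ‖X k - x₀‖ ^ 2 :=
      Finset.sum_nonneg fun k _ => mul_nonneg (hp k) (sq_nonneg _)
    set E := ∑ k, p k • (X k - x₀)
    have h2 : ‖E‖ ≤ √(κ ^ 2 + ‖E‖ ^ 2) := Real.le_sqrt_of_sq_le (by nlinarith [sq_nonneg κ])
    have h3 : ∑ k, p k * V T (X k) - V T x₀ = ∑ k, p k * q (X k) - q x₀ := by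
      rw [hV.2 x₀ hx₀]
      congr 1
      exact Finset.sum_congr rfl fun k _ => by rw [hV.2 _ (hX k)]
    rw [h3]
    refine h1.trans ?_
    rw [pow_zero, mul_one, add_comm]
    refine add_le_add (mul_le_mul_of_nonneg_right ?_ hS)
      (mul_le_mul (by linarith) h2 (norm_nonneg _) (by linarith))
    nlinarith
  · intro k t ht ht0 htI _ _ hk ι _ p X x₀ hp hp1 hX hx₀
    set B := β * (1 + R * τ) ^ k with hB
    have hB1 : 1 ≤ B := one_le_mul_of_one_le_of_one_le hβ1
      (one_le_pow₀ (by nlinarith [mul_nonneg hR0 hτ.le]))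
    -- The control optimal at the base point is used at every `X k`: the scheme holds with equality
    -- at `x₀` and with `≤` elsewhere.
    set a := α t x₀ (gradH h (V t) x₀) with ha
    have haA : a ∈ A := (D.argmin t htI x₀ _).1
    have hBl : 0 ≤ B * l := by positivity
    have key := hk.step (V' := V (t - τ)) (c := fun x => c t x a) (b := fun x => f t x a) (N := N)
      (K := K) (C := C) hBl (by linarith) hκ hh hτ hcfl hK hC hp hp1 hX hx₀
      (fun x => D.f_speed t htI x a haA)
      (fun x y => by simpa using D.c_lip t htI t htI x y a haA)
      (fun x y => by simpa using D.f_lip t htI t htI x y a haA)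
      (D.c_semi t htI a haA) (D.f_semi t htI a haA) (D.f_semi_neg t htI a haA)
      (fun x hx => by
        rw [hV.step_eq hτ ht ht0 hx]
        have := mul_le_mul_of_nonneg_left (D.hamiltonian_le htI x (gradH h (V t) x) haA) hτ.le
        linarith)
      (by rw [hV.step_eq hτ ht ht0 hx₀, D.hamiltonian_eq htI])
    have hS : 0 ≤ ∑ k, p k * ‖X k - x₀‖ ^ 2 :=
      Finset.sum_nonneg fun k _ => mul_nonneg (hp k) (sq_nonneg _)
    refine key.trans (add_le_add (mul_le_mul_of_nonneg_right ?_ hS)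
      (mul_le_mul_of_nonneg_right ?_ (Real.sqrt_nonneg _)))
    · have e : β * (1 + R * τ) ^ (k + 1) * l = B * l + τ * (R * (B * l)) := by
        rw [hB, pow_succ]; ring
      rw [e]
      refine add_le_add le_rfl (mul_le_mul_of_nonneg_left ?_ hτ.le)
      have h1 : 1 ≤ B * l := one_le_mul_of_one_le_of_one_le hB1 hl1
      have h2 : C * 1 ≤ C * (B * l) := mul_le_mul_of_nonneg_left h1 hC
      have h3 : d * (B * (C * (1 + 4 * (h / κ)))) ≤ 4 * d * C * (B * l) := by
        have h4 : 1 + 4 * (h / κ) ≤ 4 * l := by rw [hl]; linarith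
        calc d * (B * (C * (1 + 4 * (h / κ)))) ≤ d * (B * (C * (4 * l))) := by gcongr
          _ = _ := by ring
      have h5 : 0 ≤ d * K * (B * l) := by positivity
      have h6 : 0 ≤ K * (B * l) := by positivity
      have e2 : R * (B * l) = 4 * d * K * (B * l) + C * (B * l) + 4 * d * C * (B * l) +
        d * K * (B * l) + K * (B * l) := by rw [hR]; ring
      linarith
    · have e : β * (1 + R * τ) ^ (k + 1) = B + τ * (R * B) := by
        rw [hB, pow_succ]; ring
      rw [e]
      refine add_le_add le_rfl (mul_le_mul_of_nonneg_left ?_ hτ.le)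
      have h2 : K * 1 ≤ K * B := mul_le_mul_of_nonneg_left hB1 hK
      have h3 : 0 ≤ (4 * d * K + C + 4 * d * C) * B := by positivity
      have e2 : R * B = (4 * d * K + C + 4 * d * C) * B + d * K * B + K * B := by rw [hR]; ring
      linarith

end

/-! ### Comparison with smooth barriers -/

/-- The supersolution property of `v` for `∂ₜv + H = 0` on `(0,T) × ℝᵈ`, against `C¹` test
functions. -/
def ViscositySuper {d : ℕ} (T : ℝ) (H : ℝ → Eu d → Eu d → ℝ) (v : ℝ → Eu d → ℝ) : Prop :=
  ∀ φ : ℝ → Eu d → ℝ, ContDiff ℝ 1 (fun z : ℝ × Eu d => φ z.1 z.2) →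
    ∀ t ∈ Ioo (0 : ℝ) T, ∀ x : Eu d,
      IsLocalMin (fun z : ℝ × Eu d => v z.1 z.2 - φ z.1 z.2) (t, x) →
        deriv (fun s => φ s x) t + H t x (gradient (φ t) x) ≤ 0

section
variable {d : ℕ} {T : ℝ} {H : ℝ → Eu d → Eu d → ℝ} {v : ℝ → Eu d → ℝ}

theorem gradient_neg_apply (g : Eu d → ℝ) (x : Eu d) :
    gradient (fun y => -g y) x = -gradient g x := by
  simp [gradient, fderiv_fun_neg]

/-- A smooth strict subsolution lying below `v` at the final time of a strip lies below `v` at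
the initial time. -/
theorem ViscositySuper.smooth_le (hH : ViscositySuper T H v)
    (hc : ContinuousOn (fun z : ℝ × Eu d => v z.1 z.2) (Icc (0 : ℝ) T ×ˢ univ))
    {M : ℝ} (hM : ∀ t ∈ Icc (0 : ℝ) T, ∀ x : Eu d, |v t x| ≤ M) {r₀ r₁ : ℝ} (h0 : 0 ≤ r₀)
    (h01 : r₀ < r₁) (h1 : r₁ ≤ T) {ψ : ℝ → Eu d → ℝ}
    (hψ : ContDiff ℝ 1 (fun z : ℝ × Eu d => ψ z.1 z.2)) (hterm : ∀ x, ψ r₁ x ≤ v r₁ x)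
    (hstrict : ∀ t ∈ Ioo r₀ r₁, ∀ x, 0 < deriv (fun s => ψ s x) t + H t x (gradient (ψ t) x))
    {c₀ : ℝ} (hcoer : ∀ t ∈ Icc r₀ r₁, ∀ x, ψ t x ≤ c₀ - ‖x‖) (x : Eu d) :
    ψ r₀ x ≤ v r₀ x := by
  have hsub : Icc r₀ r₁ ⊆ Icc 0 T := Icc_subset_Icc h0 h1
  have hinner : ∀ t₁ ∈ Ioo r₀ r₁, ψ t₁ x ≤ v t₁ x := by
    intro t₁ ht₁
    by_contra! hlt
    set η := ψ t₁ x - v t₁ x with hη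
    have hη0 : 0 < η := by linarith
    set B := max (c₀ + M) 0 + 1 with hB
    have hB0 : 0 < B := by positivity
    have hδ : 0 < t₁ - r₀ := by linarith [ht₁.1]
    set k := B / (η * (t₁ - r₀)) with hk
    have hk0 : 0 < k := by positivity
    -- At `r₀` the penalty equals `B`, more than `ψ - v` can be, so the minimum of `v - φ` avoids
    -- the initial time. At `t₁` it is below `η`, because `B / η < exp (B / η)`. Since `φ - ψ`
    -- increases in time, `φ` is still a strict subsolution.
    set φ : ℝ → Eu d → ℝ := fun t y => ψ t y - B * Real.exp (-k * (t - r₀)) with hφ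
    have hφc : ContDiff ℝ 1 (fun z : ℝ × Eu d => φ z.1 z.2) := by
      refine hψ.sub ?_
      fun_prop
    have hval : v t₁ x - φ t₁ x < 0 := by
      have e1 : k * (t₁ - r₀) = B / η := by rw [hk]; field_simp
      have e2 : B / η < Real.exp (k * (t₁ - r₀)) := by
        have := Real.add_one_le_exp (k * (t₁ - r₀))
        linarith
      have e3 : B * Real.exp (-k * (t₁ - r₀)) < η := by
        rw [neg_mul, Real.exp_neg, ← div_eq_mul_inv, div_lt_iff₀ (Real.exp_pos _)]
        rwa [div_lt_iff₀ hη0, mul_comm] at e2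
      simp only [hφ]
      linarith
    set R := max (c₀ + M) ‖x‖ with hR
    have hout : ∀ t ∈ Icc r₀ r₁, ∀ y : Eu d, R < ‖y‖ → 0 < v t y - φ t y := by
      intro t ht y hy
      have a1 := hcoer t ht y
      have a2 := neg_le_of_abs_le (hM t (hsub ht) y)
      have a3 : c₀ + M ≤ R := le_max_left _ _
      have a4 : 0 ≤ B * Real.exp (-k * (t - r₀)) := by positivity
      simp only [hφ]
      linarith
    have hcont : ContinuousOn (fun z : ℝ × Eu d => v z.1 z.2 - φ z.1 z.2)
        (Icc r₀ r₁ ×ˢ Metric.closedBall 0 R) :=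
      (hc.mono (prod_mono hsub (subset_univ _))).sub hφc.continuous.continuousOn
    obtain ⟨⟨t₂, x₂⟩, hmem, hmin⟩ :=
      (isCompact_Icc.prod (isCompact_closedBall (0 : Eu d) R)).exists_isMinOn
        ⟨(t₁, x), ⟨ht₁.1.le, ht₁.2.le⟩, by
          rw [mem_closedBall_zero_iff]; exact le_max_right _ _⟩ hcont
    have hxt : (t₁, x) ∈ Icc r₀ r₁ ×ˢ Metric.closedBall (0 : Eu d) R :=
      ⟨⟨ht₁.1.le, ht₁.2.le⟩, by rw [mem_closedBall_zero_iff]; exact le_max_right _ _⟩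
    have hneg : v t₂ x₂ - φ t₂ x₂ < 0 := lt_of_le_of_lt (hmin hxt) hval
    have ht₂ : t₂ ∈ Icc r₀ r₁ := hmem.1
    have hne0 : t₂ ≠ r₀ := by
      rintro rfl
      have a1 := hcoer t₂ ht₂ x₂
      have a2 := neg_le_of_abs_le (hM t₂ (hsub ht₂) x₂)
      have a3 : c₀ + M ≤ max (c₀ + M) 0 := le_max_left _ _
      simp only [hφ, sub_self, mul_zero, Real.exp_zero, mul_one] at hneg
      linarith [norm_nonneg x₂]
    have hne1 : t₂ ≠ r₁ := by
      rintro rfl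
      have a1 := hterm x₂
      have a4 : 0 ≤ B * Real.exp (-k * (t₂ - r₀)) := by positivity
      simp only [hφ] at hneg
      linarith
    have hIoo : t₂ ∈ Ioo r₀ r₁ := ⟨lt_of_le_of_ne ht₂.1 hne0.symm, lt_of_le_of_ne ht₂.2 hne1⟩
    have hloc : IsLocalMin (fun z : ℝ × Eu d => v z.1 z.2 - φ z.1 z.2) (t₂, x₂) := by
      have hnear : ∀ᶠ z : ℝ × Eu d in 𝓝 (t₂, x₂), z.1 ∈ Ioo r₀ r₁ :=
        continuous_fst.continuousAt.eventually (isOpen_Ioo.mem_nhds hIoo)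
      filter_upwards [hnear] with z hz
      have hz' : z.1 ∈ Icc r₀ r₁ := Ioo_subset_Icc_self hz
      by_cases hzR : ‖z.2‖ ≤ R
      · exact hmin ⟨hz', by rwa [mem_closedBall_zero_iff]⟩
      · exact (hneg.trans (hout z.1 hz' z.2 (not_le.1 hzR))).le
    have hvisc := hH φ hφc t₂ ⟨h0.trans_lt hIoo.1, hIoo.2.trans_le h1⟩ x₂ hloc
    have hgrad : gradient (φ t₂) x₂ = gradient (ψ t₂) x₂ := by
      simp only [hφ, gradient, fderiv_sub_const]
    have hdψ : DifferentiableAt ℝ (fun s => ψ s x₂) t₂ :=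
      ((hψ.comp (contDiff_id.prodMk contDiff_const)).differentiable one_ne_zero).differentiableAt
    have hdexp : HasDerivAt (fun s => B * Real.exp (-k * (s - r₀)))
        (B * (Real.exp (-k * (t₂ - r₀)) * (-k * 1))) t₂ :=
      ((((hasDerivAt_id t₂).sub_const r₀).const_mul (-k)).exp).const_mul B
    have hder : deriv (fun s => φ s x₂) t₂ = deriv (fun s => ψ s x₂) t₂ -
        B * (Real.exp (-k * (t₂ - r₀)) * (-k * 1)) := (hdψ.hasDerivAt.sub hdexp).deriv
    rw [hgrad, hder] at hvisc
    have := hstrict t₂ hIoo x₂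
    have hpos : 0 < B * (Real.exp (-k * (t₂ - r₀)) * k) := by positivity
    linarith
  have hcv : ContinuousOn (fun t => v t x) (Icc r₀ r₁) := by
    have : ContinuousOn (fun t : ℝ => (t, x)) (Icc r₀ r₁) := by fun_prop
    exact hc.comp this fun t ht => ⟨hsub ht, mem_univ _⟩
  have hv_tendsto : Tendsto (fun t => v t x) (𝓝[>] r₀) (𝓝 (v r₀ x)) := by
    have := (hcv r₀ ⟨le_rfl, h01.le⟩)
    exact this.mono_left (nhdsWithin_le_of_mem (Icc_mem_nhdsGT h01))
  have hψ_tendsto : Tendsto (fun t => ψ t x) (𝓝[>] r₀) (𝓝 (ψ r₀ x)) := by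
    have : Continuous (fun t => ψ t x) := hψ.continuous.comp (by fun_prop : Continuous
      (fun t : ℝ => (t, x)))
    exact (this.tendsto r₀).mono_left nhdsWithin_le_nhds
  exact le_of_tendsto_of_tendsto hψ_tendsto hv_tendsto
    (Filter.mem_of_superset (Ioo_mem_nhdsGT h01) hinner)

theorem deriv_affine_time (P Q : ℝ) (s t : ℝ) :
    deriv (fun r : ℝ => P + (s - r) * Q) t = -Q := by
  have : HasDerivAt (fun r : ℝ => P + (s - r) * Q) ((-1) * Q) t :=
    (((hasDerivAt_id t).const_sub s).mul_const Q).const_add P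
  rw [this.deriv]
  ring

/-- Comparison with a barrier which is affine in time. -/
theorem ViscositySuper.barrier_le (hH : ViscositySuper T H v)
    (hc : ContinuousOn (fun z : ℝ × Eu d => v z.1 z.2) (Icc (0 : ℝ) T ×ˢ univ))
    {M : ℝ} (hM : ∀ t ∈ Icc (0 : ℝ) T, ∀ x : Eu d, |v t x| ≤ M) {s τ : ℝ} (h0 : 0 ≤ s - τ)
    (hτ : 0 < τ) (h1 : s ≤ T) {P Q : Eu d → ℝ} {gP gQ : Eu d → Eu d} (hP : ContDiff ℝ 1 P)
    (hQ : ContDiff ℝ 1 Q) (hgP : ∀ x, HasGradientAt P (gP x) x)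
    (hgQ : ∀ x, HasGradientAt Q (gQ x) x) (hterm : ∀ x, P x ≤ v s x)
    (hstrict : ∀ t ∈ Ioo (s - τ) s, ∀ x, 0 < -Q x + H t x (gP x + (s - t) • gQ x))
    {c₀ : ℝ} (hcoer : ∀ θ ∈ Icc 0 τ, ∀ x, P x + θ * Q x ≤ c₀ - ‖x‖) (x : Eu d) :
    P x + τ * Q x ≤ v (s - τ) x := by
  have hgrad : ∀ t x, gradient (fun y => P y + (s - t) * Q y) x = gP x + (s - t) • gQ x := by
    intro t x
    refine HasGradientAt.gradient ?_
    have h2 := (hgP x).hasFDerivAt.add ((hgQ x).hasFDerivAt.const_mul (s - t))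
    rw [hasGradientAt_iff_hasFDerivAt, map_add, map_smul]
    exact h2
  have := hH.smooth_le hc hM (r₀ := s - τ) (r₁ := s) h0 (by linarith) h1
    (ψ := fun t x => P x + (s - t) * Q x) (c₀ := c₀)
    ((hP.comp contDiff_snd).add ((contDiff_const.sub contDiff_fst).mul (hQ.comp contDiff_snd)))
    (fun x => by simpa using hterm x)
    (fun t ht x => by
      rw [deriv_affine_time, hgrad]
      exact hstrict t ht x)
    (fun t ht x => hcoer (s - t) ⟨by linarith [ht.2], by linarith [ht.1]⟩ x) x
  simpa using this

/-- Reflection `v ↦ -v`, by which upper barriers follow from lower ones. -/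
theorem ViscositySuper.neg_of_sub {q : Eu d → ℝ} (hv : IsViscositySolution T H q v) :
    ViscositySuper T (fun t x p => -H t x (-p)) (fun t x => -v t x) := by
  intro φ hφ t ht x hmin
  have h1 := hv.subsolution (fun t x => -φ t x) hφ.neg t ht x (by
    have := hmin.neg
    refine this.congr (Eventually.of_forall fun z => ?_)
    simp only
    ring)
  rw [gradient_neg_apply] at h1
  have e : deriv (fun s => -φ s x) t = -deriv (fun s => φ s x) t := deriv.fun_neg
  rw [e] at h1
  simp only
  linarith

theorem IsViscositySolution.barrier_le {q : Eu d → ℝ} (hv : IsViscositySolution T H q v)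
    {s τ : ℝ} (h0 : 0 ≤ s - τ)
    (hτ : 0 < τ) (h1 : s ≤ T) {P Q : Eu d → ℝ} {gP gQ : Eu d → Eu d} (hP : ContDiff ℝ 1 P)
    (hQ : ContDiff ℝ 1 Q) (hgP : ∀ x, HasGradientAt P (gP x) x)
    (hgQ : ∀ x, HasGradientAt Q (gQ x) x) (hterm : ∀ x, P x ≤ v s x)
    (hstrict : ∀ t ∈ Ioo (s - τ) s, ∀ x, 0 < -Q x + H t x (gP x + (s - t) • gQ x))
    {c₀ : ℝ} (hcoer : ∀ θ ∈ Icc 0 τ, ∀ x, P x + θ * Q x ≤ c₀ - ‖x‖) (x : Eu d) :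
    P x + τ * Q x ≤ v (s - τ) x := by
  obtain ⟨M, hM⟩ := hv.bounded
  exact ViscositySuper.barrier_le hv.supersolution hv.continuousOn hM h0 hτ h1 hP hQ hgP hgQ hterm
    hstrict hcoer x

theorem IsViscositySolution.le_barrier {q : Eu d → ℝ} (hv : IsViscositySolution T H q v)
    {s τ : ℝ} (h0 : 0 ≤ s - τ)
    (hτ : 0 < τ) (h1 : s ≤ T) {P Q : Eu d → ℝ} {gP gQ : Eu d → Eu d} (hP : ContDiff ℝ 1 P)
    (hQ : ContDiff ℝ 1 Q) (hgP : ∀ x, HasGradientAt P (gP x) x)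
    (hgQ : ∀ x, HasGradientAt Q (gQ x) x) (hterm : ∀ x, v s x ≤ P x)
    (hstrict : ∀ t ∈ Ioo (s - τ) s, ∀ x, -Q x + H t x (gP x + (s - t) • gQ x) < 0)
    {c₀ : ℝ} (hcoer : ∀ θ ∈ Icc 0 τ, ∀ x, ‖x‖ - c₀ ≤ P x + θ * Q x) (x : Eu d) :
    v (s - τ) x ≤ P x + τ * Q x := by
  obtain ⟨M, hM⟩ := hv.bounded
  have hneg : ∀ {g : Eu d → ℝ} {g' x : Eu d}, HasGradientAt g g' x →
      HasGradientAt (fun y => -g y) (-g') x := by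
    intro g g' x hg
    rw [hasGradientAt_iff_hasFDerivAt, map_neg]
    exact hg.hasFDerivAt.neg
  have := ViscositySuper.barrier_le (ViscositySuper.neg_of_sub hv) hv.continuousOn.neg (M := M)
    (fun t ht x => by simpa using hM t ht x) h0 hτ h1 (P := fun x => -P x) (Q := fun x => -Q x)
    hP.neg hQ.neg
    (fun x => hneg (hgP x)) (fun x => hneg (hgQ x)) (fun x => neg_le_neg (hterm x))
    (fun t ht x => by
      have e : -(-gP x + (s - t) • -gQ x) = gP x + (s - t) • gQ x := by module
      have := hstrict t ht x
      rw [e]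
      linarith)
    (c₀ := c₀) (fun θ hθ x => by
      have := hcoer θ hθ x
      linarith) x
  linarith

end

/-! ### One-step comparison of the scheme with the viscosity solution -/

section
variable {d : ℕ} {h τ N : ℝ}

theorem schemeAvg_mono (hh : 0 < h) (hτ : 0 < τ) (hcfl : 2 * d * N * τ ≤ h) {b : Eu d}
    (hb : ‖b‖ ≤ 2 * N) {V W : Eu d → ℝ} (hVW : ∀ y ∈ spaceGrid d h, V y ≤ W y) {x : Eu d}
    (hx : x ∈ spaceGrid d h) : schemeAvg h τ N b V x ≤ schemeAvg h τ N b W x := by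
  have hstay : 0 ≤ 1 - 2 * d * N * τ / h := by
    rw [sub_nonneg, div_le_one hh]
    exact hcfl
  have hρ : 0 ≤ τ / (2 * h) := by positivity
  refine add_le_add (mul_le_mul_of_nonneg_left (hVW x hx) hstay)
    (Finset.sum_le_sum fun i _ => ?_)
  have hbi := abs_le.1 ((abs_apply_le_norm b i).trans hb)
  have hg := smul_stdVec_mem_spaceGrid_one h i
  exact add_le_add
    (mul_le_mul_of_nonneg_left (hVW _ (spaceGrid_add hx hg))
      (mul_nonneg hρ (by linarith [hbi.1])))
    (mul_le_mul_of_nonneg_left (hVW _ (spaceGrid_sub hx hg))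
      (mul_nonneg hρ (by linarith [hbi.2])))

/-- A step of the walk has mean `τ b` and mean square `2dNτh`, so the average of a paraboloid is
explicit. The last term is the cost of the artificial diffusion. -/
theorem schemeAvg_quadratic (hh : 0 < h) (A B : ℝ) (b x y : Eu d) :
    schemeAvg h τ N b (fun y => B + A * ‖x - y‖ ^ 2) y =
      B + A * (‖x - y‖ ^ 2 - 2 * τ * inner ℝ (x - y) b + 2 * d * N * τ * h) := by
  have h1 : ∀ i, ‖x - (y + h • stdVec i)‖ ^ 2 = ‖x - y‖ ^ 2 - 2 * h * (x - y) i + h ^ 2 := by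
    intro i
    rw [← sub_sub, norm_sub_sq_real, real_inner_comm, inner_smul_stdVec, norm_smul_stdVec hh.le]
    ring
  have h2 : ∀ i, ‖x - (y - h • stdVec i)‖ ^ 2 = ‖x - y‖ ^ 2 + 2 * h * (x - y) i + h ^ 2 := by
    intro i
    rw [← sub_add, norm_add_sq_real, real_inner_comm, inner_smul_stdVec, norm_smul_stdVec hh.le]
    ring
  have h3 : inner ℝ (x - y) b = ∑ i, (x - y) i * b i := by
    simp [PiLp.inner_apply, mul_comm]
  have h4 : ∀ i, (τ / (2 * h) * (2 * N + b i) *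
        (B + A * (‖x - y‖ ^ 2 - 2 * h * (x - y) i + h ^ 2)) +
      τ / (2 * h) * (2 * N - b i) * (B + A * (‖x - y‖ ^ 2 + 2 * h * (x - y) i + h ^ 2))) =
      2 * N * τ / h * (B + A * (‖x - y‖ ^ 2 + h ^ 2)) - 2 * τ * A * ((x - y) i * b i) := by
    intro i
    field_simp
    ring
  simp only [schemeAvg, h1, h2, h4]
  simp only [Finset.sum_sub_distrib, ← Finset.mul_sum, ← h3, Finset.sum_const, Finset.card_univ,
    Fintype.card_fin, nsmul_eq_mul]
  field_simp
  ring

end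

section
variable {d : ℕ}

/-- A quadratic polynomial. -/
noncomputable def quad (k : ℝ) (w y : Eu d) (g : ℝ) (z : Eu d) (g' : ℝ) (x : Eu d) : ℝ :=
  k + inner ℝ w (x - y) + g * ‖x - y‖ ^ 2 + g' * ‖x - z‖ ^ 2

theorem contDiff_quad (k : ℝ) (w y : Eu d) (g : ℝ) (z : Eu d) (g' : ℝ) :
    ContDiff ℝ 1 (quad k w y g z g') := by
  have h1 : ∀ y : Eu d, ContDiff ℝ 1 (fun x : Eu d => ‖x - y‖ ^ 2) := fun y =>
    (contDiff_id.sub contDiff_const).norm_sq ℝ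
  have h2 : ContDiff ℝ 1 (fun x : Eu d => inner ℝ w (x - y)) :=
    contDiff_const.inner ℝ (contDiff_id.sub contDiff_const)
  exact ((contDiff_const.add h2).add (contDiff_const.mul (h1 y))).add (contDiff_const.mul (h1 z))

theorem hasGradientAt_quad (k : ℝ) (w y : Eu d) (g : ℝ) (z : Eu d) (g' : ℝ) (x : Eu d) :
    HasGradientAt (quad k w y g z g') (w + (2 * g) • (x - y) + (2 * g') • (x - z)) x := by
  have h0 : ∀ y : Eu d, HasFDerivAt (fun x : Eu d => x - y) (ContinuousLinearMap.id ℝ (Eu d)) x :=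
    fun y => (hasFDerivAt_id x).sub_const y
  have h1 := fun y => (h0 y).norm_sq
  have h2 : HasFDerivAt (fun x : Eu d => inner ℝ w (x - y)) (innerSL ℝ w) x :=
    (innerSL ℝ w).hasFDerivAt.comp x (h0 y)
  have h3 := ((h2.const_add k).add ((h1 y).const_mul g)).add ((h1 z).const_mul g')
  rw [hasGradientAt_iff_hasFDerivAt]
  refine h3.congr_fderiv ?_
  ext u
  simp
  ring

end

theorem linear_le_quadratic {g : ℝ} (hg : 0 < g) (L r : ℝ) : L * r ≤ g * r ^ 2 + L ^ 2 / (4 * g) := by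
  have e : g * r ^ 2 + L ^ 2 / (4 * g) - L * r = (L - 2 * g * r) ^ 2 / (4 * g) := by
    field_simp
    ring
  have : 0 ≤ (L - 2 * g * r) ^ 2 / (4 * g) := by positivity
  linarith

/-- Here `r = ‖x - y‖`, and `K (τ + r)` is the oscillation of `c` and `f` between `(t,x)` and
`(s,y)`. The weight `g (2K + 1)` beats the term `2gK r²` with `g r²` to spare, which absorbs the
terms linear in `r`. -/
theorem consistency_error_le {g τ K : ℝ} (hg : 0 < g) (r : ℝ) :
    K * (τ + r) + 2 * g * (r * (K * (τ + r))) + 2 * g * τ * K ^ 2 +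
      2 * τ * (g * (2 * K + 1)) * (r * K) - g * (2 * K + 1) * r ^ 2 ≤
      K * τ + 2 * K ^ 2 * g * τ + (K + g * τ * (4 * K ^ 2 + 4 * K)) ^ 2 / (4 * g) := by
  have := linear_le_quadratic hg (K + g * τ * (4 * K ^ 2 + 4 * K)) r
  nlinarith

theorem inner_le_mul {d : ℕ} {x y : Eu d} {a b : ℝ} (hx : ‖x‖ ≤ a) (hy : ‖y‖ ≤ b) :
    |inner ℝ x y| ≤ a * b :=
  (abs_real_inner_le_norm x y).trans (mul_le_mul hx hy (norm_nonneg _) ((norm_nonneg _).trans hx))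

section
variable {d m : ℕ} {T N K C : ℝ} {A : Set (Eu m)} {c : ℝ → Eu d → Eu m → ℝ}
  {f : ℝ → Eu d → Eu m → Eu d} {q : Eu d → ℝ} {α : ℝ → Eu d → Eu d → Eu m} {v : ℝ → Eu d → ℝ}
  {h τ s g B e : ℝ} {V₀ V₁ : Eu d → ℝ}

/-- One time step of the comparison of the viscosity solution with the scheme, from above. -/
theorem ControlData.viscosity_le_step (D : ControlData T N K C A c f q α)
    (hv : IsViscositySolution T (hamiltonian A c f) q v) (hh : 0 < h) (hτ : 0 < τ)
    (hcfl : 2 * d * N * τ ≤ h) (hs : s ∈ Icc 0 T) (hs' : s - τ ∈ Icc 0 T)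
    (hV : ∀ y ∈ spaceGrid d h, V₀ y = V₁ y + τ * hamiltonian A c f s y (gradH h V₁ y) +
      τ * (N * h * laplH h V₁ y)) (hg : 0 < g)
    (he : (K + 1) * τ + 11 * K ^ 2 * g * τ + (K + g * τ * (4 * K ^ 2 + 4 * K)) ^ 2 / (4 * g) ≤ e)
    (hind : ∀ y ∈ spaceGrid d h, ∀ x, v s x ≤ V₁ y + g * ‖x - y‖ ^ 2 + B)
    {y : Eu d} (hy : y ∈ spaceGrid d h) (x : Eu d) :
    v (s - τ) x ≤ V₀ y + g * (1 + (2 * K + 1) * τ) * ‖x - y‖ ^ 2 +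
      (B + τ * (e + 2 * d * N * g * h)) := by
  have hK := D.K_nonneg
  set a := α s y (gradH h V₁ y) with ha
  have haA : a ∈ A := (D.argmin s hs y _).1
  set b := f s y a with hb
  set c' := c s y a with hc'
  have hbK : ‖b‖ ≤ K := D.f_bound s hs y a haA
  have hV₀ : V₀ y = τ * c' + schemeAvg h τ N b V₁ y := by
    rw [hV y hy, D.hamiltonian_eq hs, ← scheme_eq_schemeAvg hh]
  set G := g * (2 * K + 1) with hG
  set k₀ := V₀ y - τ * c' + 2 * g * d * N * τ * h + B with hk₀
  -- For fixed `x`, `hind` bounds `V₁` from below by a paraboloid at all grid points; averaging it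
  -- over one step from `y` gives a bound on `v s x`.
  have hterm : ∀ x, v s x ≤ quad k₀ ((-2 * g * τ) • b) y g y 0 x := by
    intro x
    have h1 := schemeAvg_mono hh hτ hcfl (D.f_speed s hs y a haA)
      (V := fun y => (v s x - B) + (-g) * ‖x - y‖ ^ 2) (W := V₁)
      (fun y' hy' => by linarith [hind y' hy' x]) hy
    rw [schemeAvg_quadratic hh, ← hb] at h1
    rw [quad, real_inner_smul_left, real_inner_comm]
    linarith
  -- The linear term of `Q` transports the paraboloid along the drift and cancels that of `P` after
  -- time `τ`. Strictness comes from the summand `τ` within `(K + 1) * τ`.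
  have key := hv.le_barrier hs'.1 hτ hs.2 (contDiff_quad k₀ ((-2 * g * τ) • b) y g y 0)
    (contDiff_quad (c' + e) ((2 * g) • b) y G y 0) (hasGradientAt_quad _ _ _ _ _ _)
    (hasGradientAt_quad _ _ _ _ _ _) hterm
    (fun t ht x => by
      set θ := s - t with hθ
      have hθ0 : 0 ≤ θ := by linarith [ht.2]
      have hθτ : θ ≤ τ := by linarith [ht.1]
      have htI : t ∈ Icc 0 T := ⟨hs'.1.trans ht.1.le, ht.2.le.trans hs.2⟩
      have habs : |t - s| ≤ τ := by rw [abs_le]; constructor <;> linarith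
      set Δ := x - y with hΔ
      set r := ‖Δ‖ with hr
      have hr0 : 0 ≤ r := norm_nonneg _
      set b' := f t x a with hb'
      have hKr : K * (|t - s| + ‖x - y‖) ≤ K * (τ + r) :=
        mul_le_mul_of_nonneg_left (by linarith) hK
      have h1 := (le_of_abs_le (D.c_lip t htI s hs x y a haA)).trans hKr
      have h2 := (D.f_lip t htI s hs x y a haA).trans hKr
      have h3 : ‖b'‖ ≤ K := D.f_bound t htI x a haA
      have i1 := le_of_abs_le (inner_le_mul (le_refl ‖Δ‖) h2)
      have i2 := neg_le_of_abs_le (inner_le_mul hbK h3)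
      have i3 := le_of_abs_le (inner_le_mul (le_refl ‖Δ‖) h3)
      rw [inner_sub_right] at i1
      have hH := D.hamiltonian_le htI x ((-2 * g * τ) • b + (2 * g) • Δ + (2 * (0 : ℝ)) • Δ +
        θ • ((2 * g) • b + (2 * G) • Δ + (2 * (0 : ℝ)) • Δ)) haA
      have e1 : inner ℝ ((-2 * g * τ) • b + (2 * g) • Δ + (2 * (0 : ℝ)) • Δ +
          θ • ((2 * g) • b + (2 * G) • Δ + (2 * (0 : ℝ)) • Δ)) b' =
          2 * g * (τ - θ) * -inner ℝ b b' + 2 * g * inner ℝ Δ b' + 2 * G * (θ * inner ℝ Δ b') := by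
        simp only [inner_add_left, real_inner_smul_left]
        ring
      rw [← hb', e1] at hH
      have hG0 : 0 ≤ G := by positivity
      have j1 : 2 * g * (τ - θ) * -inner ℝ b b' ≤ 2 * g * τ * K ^ 2 := by
        calc 2 * g * (τ - θ) * -inner ℝ b b' ≤ 2 * g * (τ - θ) * K ^ 2 :=
              mul_le_mul_of_nonneg_left (by linarith)
                (mul_nonneg (by positivity) (by linarith))
          _ ≤ 2 * g * τ * K ^ 2 := by gcongr; linarith
      have j2 : 2 * g * inner ℝ Δ b' ≤ 2 * g * (inner ℝ Δ b + r * (K * (τ + r))) :=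
        mul_le_mul_of_nonneg_left (by linarith) (by positivity)
      have j3 : 2 * G * (θ * inner ℝ Δ b') ≤ 2 * G * (τ * (r * K)) := by
        refine mul_le_mul_of_nonneg_left ?_ (by positivity)
        calc θ * inner ℝ Δ b' ≤ θ * (r * K) := mul_le_mul_of_nonneg_left i3 hθ0
          _ ≤ τ * (r * K) := mul_le_mul_of_nonneg_right hθτ (by positivity)
      have j4 := consistency_error_le (τ := τ) (K := K) hg r
      rw [← hG] at j4
      have j5 : 0 ≤ 9 * K ^ 2 * g * τ := by positivity
      rw [quad, real_inner_smul_left, real_inner_comm, ← hΔ]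
      linarith)
    (c₀ := |k₀| + τ * |c' + e| + ‖y‖ + (2 * g * τ * K + 1) ^ 2 / (4 * g))
    (fun θ hθ x => by
      set Δ := x - y with hΔ
      set r := ‖Δ‖ with hr
      have hr0 : 0 ≤ r := norm_nonneg _
      have hx : ‖x‖ ≤ ‖y‖ + r := by
        calc ‖x‖ = ‖y + Δ‖ := by rw [hΔ, add_sub_cancel]
          _ ≤ _ := norm_add_le _ _
      have h1 := linear_le_quadratic hg (2 * g * τ * K + 1) r
      have h2 : θ * |c' + e| ≤ τ * |c' + e| := mul_le_mul_of_nonneg_right hθ.2 (abs_nonneg _)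
      have h3 : -(θ * |c' + e|) ≤ θ * (c' + e) := by
        have := mul_le_mul_of_nonneg_left (neg_abs_le (c' + e)) hθ.1
        linarith
      have h4 := le_of_abs_le (inner_le_mul hbK (le_refl ‖Δ‖))
      have h5 : 2 * g * (τ - θ) * inner ℝ b Δ ≤ 2 * g * τ * (K * r) := by
        calc 2 * g * (τ - θ) * inner ℝ b Δ ≤ 2 * g * (τ - θ) * (K * r) :=
              mul_le_mul_of_nonneg_left h4 (mul_nonneg (by positivity) (by linarith [hθ.2]))
          _ ≤ 2 * g * τ * (K * r) := by gcongr; linarith [hθ.1]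
      have h6 : 0 ≤ θ * (G * r ^ 2) := mul_nonneg hθ.1 (by positivity)
      simp only [quad, real_inner_smul_left, ← hΔ, ← hr]
      linarith [neg_abs_le k₀]) x
  refine key.trans (le_of_eq ?_)
  simp only [quad, real_inner_smul_left, hk₀, hG]
  ring

/-- One time step of the comparison of the scheme with the viscosity solution, from above. -/
theorem ControlData.scheme_le_step (D : ControlData T N K C A c f q α)
    (hv : IsViscositySolution T (hamiltonian A c f) q v) (hh : 0 < h) (hτ : 0 < τ)
    (hcfl : 2 * d * N * τ ≤ h) (hs : s ∈ Icc 0 T) (hs' : s - τ ∈ Icc 0 T)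
    (hV : ∀ y ∈ spaceGrid d h, V₀ y = V₁ y + τ * hamiltonian A c f s y (gradH h V₁ y) +
      τ * (N * h * laplH h V₁ y)) (hg : 0 < g)
    (he : (K + 1) * τ + 11 * K ^ 2 * g * τ + (K + g * τ * (4 * K ^ 2 + 4 * K)) ^ 2 / (4 * g) ≤ e)
    (hind : ∀ y ∈ spaceGrid d h, ∀ x, V₁ y ≤ v s x + g * ‖x - y‖ ^ 2 + B)
    {y : Eu d} (hy : y ∈ spaceGrid d h) (x₁ : Eu d) :
    V₀ y ≤ v (s - τ) x₁ + g * (1 + (2 * K + 1) * τ) * ‖x₁ - y‖ ^ 2 +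
      (B + τ * (e + 2 * d * N * g * h)) := by
  have hK := D.K_nonneg
  -- The slope of `-g ‖· - y‖²` at the target `x₁`. The Hamiltonian of the barrier picks its own
  -- minimiser `a'`, and optimality of `a` at the fixed slope `p'` makes the two controls
  -- comparable.
  set p' : Eu d := (-2 * g) • (x₁ - y) with hp'
  set a := α s y p' with ha
  have haA : a ∈ A := (D.argmin s hs y _).1
  set b := f s y a with hb
  set c' := c s y a with hc'
  have hbK : ‖b‖ ≤ K := D.f_bound s hs y a haA
  have hV₀ : V₀ y ≤ τ * c' + schemeAvg h τ N b V₁ y := by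
    rw [hV y hy, ← scheme_eq_schemeAvg hh]
    have := mul_le_mul_of_nonneg_left (D.hamiltonian_le hs y (gradH h V₁ y) haA) hτ.le
    linarith
  set G := g * (2 * K + 1) with hG
  have hG0 : 0 ≤ G := by positivity
  set k₀ := V₀ y - τ * c' - 2 * g * d * N * τ * h - B with hk₀
  have hterm : ∀ x, quad k₀ ((2 * g * τ) • b) y (-g) y 0 x ≤ v s x := by
    intro x
    have h1 := schemeAvg_mono hh hτ hcfl (D.f_speed s hs y a haA)
      (V := V₁) (W := fun y => (v s x + B) + g * ‖x - y‖ ^ 2)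
      (fun y' hy' => by linarith [hind y' hy' x]) hy
    rw [schemeAvg_quadratic hh, ← hb] at h1
    rw [quad, real_inner_smul_left, real_inner_comm]
    linarith
  -- The extra term `-(g / τ) ‖x - x₁‖²` in `Q` vanishes at `x₁`, where the barrier is finally
  -- evaluated, and pays for comparing slopes at `x` and `x₁`.
  have key := hv.barrier_le hs'.1 hτ hs.2 (contDiff_quad k₀ ((2 * g * τ) • b) y (-g) y 0)
    (contDiff_quad (c' - e) ((-2 * g) • b) y (-G) x₁ (-(g / τ))) (hasGradientAt_quad _ _ _ _ _ _)
    (hasGradientAt_quad _ _ _ _ _ _) hterm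
    (fun t ht x => by
      set θ := s - t with hθ
      have hθ0 : 0 ≤ θ := by linarith [ht.2]
      have hθτ : θ ≤ τ := by linarith [ht.1]
      have htI : t ∈ Icc 0 T := ⟨hs'.1.trans ht.1.le, ht.2.le.trans hs.2⟩
      have habs : |t - s| ≤ τ := by rw [abs_le]; constructor <;> linarith
      have hΔz : x₁ - y = (x - y) - (x - x₁) := by abel
      set Δ := x - y with hΔ
      set z := x - x₁ with hz
      set r := ‖Δ‖ with hr
      set ζ := ‖z‖ with hζ
      have hr0 : 0 ≤ r := norm_nonneg _
      have hζ0 : 0 ≤ ζ := norm_nonneg _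
      set p := (2 * g * τ) • b + (2 * -g) • Δ + (2 * (0 : ℝ)) • Δ +
        θ • ((-2 * g) • b + (2 * -G) • Δ + (2 * -(g / τ)) • z) with hp
      set a' := α t x p with ha'
      have haA' : a' ∈ A := (D.argmin t htI x _).1
      set b' := f t x a' with hb'
      set b'' := f s y a' with hb''
      have hKr : K * (|t - s| + ‖x - y‖) ≤ K * (τ + r) :=
        mul_le_mul_of_nonneg_left (by linarith) hK
      have h1 := (neg_le_of_abs_le (D.c_lip t htI s hs x y a' haA'))
      have h2 := (D.f_lip t htI s hs x y a' haA').trans hKr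
      have h3 : ‖b'‖ ≤ K := D.f_bound t htI x a' haA'
      have h3' : ‖b''‖ ≤ K := D.f_bound s hs y a' haA'
      have i1 := le_of_abs_le (inner_le_mul (le_refl ‖Δ‖) h2)
      have i2 := neg_le_of_abs_le (inner_le_mul hbK h3)
      have i3 := le_of_abs_le (inner_le_mul (le_refl ‖Δ‖) h3)
      have i4 := le_of_abs_le (inner_le_mul (le_refl ‖z‖) h3)
      have i5 := le_of_abs_le (inner_le_mul (le_refl ‖z‖) h3')
      have i6 := neg_le_of_abs_le (inner_le_mul (le_refl ‖z‖) hbK)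
      rw [inner_sub_right] at i1
      have hmin := D.hamiltonian_le hs y p' haA'
      rw [D.hamiltonian_eq hs, ← ha, ← hb, ← hc', ← hb'', hp', real_inner_smul_left,
        real_inner_smul_left, hΔz, inner_sub_left Δ z b, inner_sub_left Δ z b''] at hmin
      have hH := D.hamiltonian_eq htI x p
      have e1 : inner ℝ p b' =
          2 * g * (τ - θ) * inner ℝ b b' - 2 * g * inner ℝ Δ b' - 2 * G * (θ * inner ℝ Δ b') -
            2 * (g / τ) * (θ * inner ℝ z b') := by
        rw [hp]
        simp only [inner_add_left, real_inner_smul_left]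
        ring
      rw [← ha', ← hb', e1] at hH
      rw [hH]
      have j1 : -(2 * g * τ * K ^ 2) ≤ 2 * g * (τ - θ) * inner ℝ b b' := by
        have : 2 * g * (τ - θ) * -inner ℝ b b' ≤ 2 * g * τ * K ^ 2 := by
          calc 2 * g * (τ - θ) * -inner ℝ b b' ≤ 2 * g * (τ - θ) * K ^ 2 :=
                mul_le_mul_of_nonneg_left (by linarith)
                  (mul_nonneg (by positivity) (by linarith))
            _ ≤ 2 * g * τ * K ^ 2 := by gcongr; linarith
        linarith
      have j2 : 2 * g * inner ℝ Δ b' ≤ 2 * g * (inner ℝ Δ b'' + r * (K * (τ + r))) :=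
        mul_le_mul_of_nonneg_left (by linarith) (by positivity)
      have j3 : 2 * G * (θ * inner ℝ Δ b') ≤ 2 * G * (τ * (r * K)) := by
        refine mul_le_mul_of_nonneg_left ?_ (by positivity)
        calc θ * inner ℝ Δ b' ≤ θ * (r * K) := mul_le_mul_of_nonneg_left i3 hθ0
          _ ≤ τ * (r * K) := mul_le_mul_of_nonneg_right hθτ (by positivity)
      have j3' : 2 * (g / τ) * (θ * inner ℝ z b') ≤ 2 * g * (ζ * K) := by
        calc 2 * (g / τ) * (θ * inner ℝ z b') ≤ 2 * (g / τ) * (τ * (ζ * K)) := by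
              refine mul_le_mul_of_nonneg_left ?_ (by positivity)
              calc θ * inner ℝ z b' ≤ θ * (ζ * K) := mul_le_mul_of_nonneg_left i4 hθ0
                _ ≤ τ * (ζ * K) := mul_le_mul_of_nonneg_right hθτ (by positivity)
          _ = _ := by field_simp
      have j4 := consistency_error_le (τ := τ) (K := K) hg r
      rw [← hG] at j4
      -- This is the `9` in the coefficient `11 = 2 + 9` of `K² g τ` in `he`; the `2` is the
      -- consistency error.
      have j5 : 6 * g * K * ζ ≤ g / τ * ζ ^ 2 + 9 * K ^ 2 * g * τ := by
        have := linear_le_quadratic (show 0 < g / τ by positivity) (6 * g * K) ζ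
        have e2 : (6 * g * K) ^ 2 / (4 * (g / τ)) = 9 * K ^ 2 * g * τ := by
          field_simp
          ring
        rwa [e2] at this
      have j6 : 2 * g * (inner ℝ z b'' - inner ℝ z b) ≤ 2 * g * (ζ * K + ζ * K) :=
        mul_le_mul_of_nonneg_left (by linarith) (by positivity)
      rw [quad, real_inner_smul_left, real_inner_comm, ← hΔ, ← hz, ← hr, ← hζ]
      linarith)
    (c₀ := |k₀| + τ * |c' - e| + ‖y‖ + (2 * g * τ * K + 1) ^ 2 / (4 * g))
    (fun θ hθ x => by
      set Δ := x - y with hΔ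
      set r := ‖Δ‖ with hr
      have hr0 : 0 ≤ r := norm_nonneg _
      have hx : ‖x‖ ≤ ‖y‖ + r := by
        calc ‖x‖ = ‖y + Δ‖ := by rw [hΔ, add_sub_cancel]
          _ ≤ _ := norm_add_le _ _
      have h1 := linear_le_quadratic hg (2 * g * τ * K + 1) r
      have h2 : θ * |c' - e| ≤ τ * |c' - e| := mul_le_mul_of_nonneg_right hθ.2 (abs_nonneg _)
      have h3 : θ * (c' - e) ≤ θ * |c' - e| :=
        mul_le_mul_of_nonneg_left (le_abs_self (c' - e)) hθ.1
      have h4 := le_of_abs_le (inner_le_mul hbK (le_refl ‖Δ‖))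
      have h5 : 2 * g * (τ - θ) * inner ℝ b Δ ≤ 2 * g * τ * (K * r) := by
        calc 2 * g * (τ - θ) * inner ℝ b Δ ≤ 2 * g * (τ - θ) * (K * r) :=
              mul_le_mul_of_nonneg_left h4 (mul_nonneg (by positivity) (by linarith [hθ.2]))
          _ ≤ 2 * g * τ * (K * r) := by gcongr; linarith [hθ.1]
      have h6 : 0 ≤ θ * (G * r ^ 2) := mul_nonneg hθ.1 (by positivity)
      have h7 : 0 ≤ θ * (g / τ * ‖x - x₁‖ ^ 2) := mul_nonneg hθ.1 (by positivity)
      simp only [quad, real_inner_smul_left, ← hΔ, ← hr]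
      linarith [le_abs_self k₀]) x₁
  have e3 : quad k₀ ((2 * g * τ) • b) y (-g) y 0 x₁ +
      τ * quad (c' - e) ((-2 * g) • b) y (-G) x₁ (-(g / τ)) x₁ =
      V₀ y - g * (1 + (2 * K + 1) * τ) * ‖x₁ - y‖ ^ 2 - (B + τ * (e + 2 * d * N * g * h)) := by
    simp only [quad, real_inner_smul_left, hk₀, hG, sub_self, norm_zero]
    ring
  rw [e3] at key
  linarith

end

/-! ### Solvability of the scheme and the rate of convergence -/

/-- The scheme is explicit, so that it has a solution. -/
theorem exists_isGridSolution {d : ℕ} {T τ : ℝ} {n : ℕ} (hτ : 0 < τ) (hn : T = n * τ) (N h : ℝ)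
    (H : ℝ → Eu d → Eu d → ℝ) (q : Eu d → ℝ) :
    ∃ V : ℝ → Eu d → ℝ, IsGridSolution T N τ h H q V := by
  let W : ℕ → Eu d → ℝ := fun k => Nat.rec q (fun k w x =>
    w x + τ * H (T - k * τ) x (gradH h w x) + τ * (N * h * laplH h w x)) k
  have hW : ∀ k x, W (k + 1) x = W k x + τ * H (T - k * τ) x (gradH h (W k) x) +
      τ * (N * h * laplH h (W k) x) := fun k x => rfl
  -- Rounding `(T - t) / τ` to the nearest integer defines `V` at all real times and returns the
  -- step number on the grid.
  let V : ℝ → Eu d → ℝ := fun t => W ⌊(T - t) / τ + 1 / 2⌋₊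
  have hVW : ∀ (k : ℕ) (t : ℝ), T - t = k * τ → V t = W k := by
    intro k t hk
    have : ⌊(T - t) / τ + 1 / 2⌋₊ = k := by
      rw [hk, mul_div_cancel_right₀ _ hτ.ne', Nat.floor_eq_iff (by positivity)]
      constructor <;> linarith
    simp only [V, this]
  refine ⟨V, fun t ⟨⟨j, hj, hjT⟩, _⟩ x _ => ?_, fun x _ => ?_⟩
  · have hjn : j ≤ n := by
      rw [hj, hn] at hjT
      exact_mod_cast le_of_mul_le_mul_right hjT hτ
    have e1 : T - t = ((n - j : ℕ) : ℝ) * τ := by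
      rw [Nat.cast_sub hjn, hj, hn]; ring
    have e2 : T - (t - τ) = ((n - j + 1 : ℕ) : ℝ) * τ := by
      push_cast
      linarith
    rw [hVW _ _ e1, hVW _ _ e2, hW, ← e1, sub_sub_cancel]
    field_simp
    ring
  · rw [hVW 0 T (by simp)]
    rfl

section
variable {d m : ℕ} {T N K C : ℝ} {A : Set (Eu m)} {c : ℝ → Eu d → Eu m → ℝ}
  {f : ℝ → Eu d → Eu m → Eu d} {q : Eu d → ℝ} {α : ℝ → Eu d → Eu d → Eu m} {v : ℝ → Eu d → ℝ}

set_option maxHeartbeats 800000 in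
/-- Uniform convergence of the scheme to the viscosity solution, with rate `√h`. -/
theorem ControlData.exists_abs_sub_le (D : ControlData T N K C A c f q α)
    (hd : 0 < d) (hN : 1 ≤ N) (hv : IsViscositySolution T (hamiltonian A c f) q v) :
    ∃ Γ : ℝ, ∀ (τ h : ℝ) (n : ℕ) (V : ℝ → Eu d → ℝ), 0 < τ → 0 < h → h ≤ 1 →
      2 * d * N * τ ≤ h → T = n * τ → IsGridSolution T N τ h (hamiltonian A c f) q V →
      ∀ t ∈ timeGrid T τ, ∀ y ∈ spaceGrid d h, |V t y - v t y| ≤ Γ * √h := by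
  have hK := D.K_nonneg
  set R : ℝ := 2 * K + 1 with hR
  have hR0 : 0 ≤ R := by positivity
  set Λ := Real.exp (R * T) with hΛ
  have hΛ0 : 0 < Λ := Real.exp_pos _
  have hd1 : (1 : ℝ) ≤ d := by exact_mod_cast hd
  set c₁ := (K + 1) + 11 * K ^ 2 * Λ + (K + Λ * (4 * K ^ 2 + 4 * K)) ^ 2 / 4 with hc₁
  have hc₁0 : 0 ≤ c₁ := by positivity
  set c₂ := c₁ + 2 * d * N * Λ with hc₂
  have hc₂0 : 0 ≤ c₂ := by positivity
  refine ⟨K ^ 2 / 4 + T * c₂, ?_⟩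
  intro τ h n V hτ hh hh1 hcfl hn hV t ht y hy
  set u := √h with hu
  have hu0 : 0 < u := Real.sqrt_pos.2 hh
  have hu2 : u ^ 2 = h := Real.sq_sqrt hh.le
  have hu1 : u ≤ 1 := Real.sqrt_le_one.2 hh1
  have hu21 : u ^ 2 ≤ u := by nlinarith
  -- The CFL condition bounds `τ` because `d ≥ 1` and `N ≥ 1`.
  have hτh : τ ≤ h := by
    have : 1 * τ ≤ 2 * d * N * τ := by
      refine mul_le_mul_of_nonneg_right ?_ hτ.le
      nlinarith
    linarith
  have hτu : τ ≤ u ^ 2 := hτh.trans hu2.ge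
  suffices ∃ k : ℕ, (k : ℝ) * τ ≤ T ∧
      ((∀ y ∈ spaceGrid d h, ∀ x, v t x ≤ V t y + 1 / u * (1 + R * τ) ^ k * ‖x - y‖ ^ 2 +
        (K ^ 2 / 4 * u + k * τ * (c₂ * u))) ∧
      (∀ y ∈ spaceGrid d h, ∀ x, V t y ≤ v t x + 1 / u * (1 + R * τ) ^ k * ‖x - y‖ ^ 2 +
        (K ^ 2 / 4 * u + k * τ * (c₂ * u)))) by
    obtain ⟨k, hkT, h1, h2⟩ := this
    have h1 := h1 y hy y
    have h2 := h2 y hy y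
    rw [sub_self, norm_zero, zero_pow two_ne_zero, mul_zero] at h1 h2
    have h3 : k * τ * (c₂ * u) ≤ T * (c₂ * u) := mul_le_mul_of_nonneg_right hkT (by positivity)
    rw [abs_le]
    constructor <;> linarith
  refine timeGrid_induction (P := fun k t =>
      (∀ y ∈ spaceGrid d h, ∀ x, v t x ≤ V t y + 1 / u * (1 + R * τ) ^ k * ‖x - y‖ ^ 2 +
        (K ^ 2 / 4 * u + k * τ * (c₂ * u))) ∧
      (∀ y ∈ spaceGrid d h, ∀ x, V t y ≤ v t x + 1 / u * (1 + R * τ) ^ k * ‖x - y‖ ^ 2 +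
        (K ^ 2 / 4 * u + k * τ * (c₂ * u)))) hτ hn ?_ ?_ ht
  · have hq : ∀ x y, |q x - q y| ≤ 1 / u * ‖x - y‖ ^ 2 + K ^ 2 / 4 * u := by
      intro x y
      refine (D.q_lip x y).trans ((linear_le_quadratic (g := 1 / u) (by positivity) _ _).trans
        (le_of_eq ?_))
      field_simp
    constructor
    · intro y hy x
      have := le_of_abs_le (hq x y)
      rw [hv.terminal, hV.2 y hy]
      simp only [pow_zero, CharP.cast_eq_zero, zero_mul, mul_one, add_zero]
      linarith
    · intro y hy x
      have := neg_le_of_abs_le (hq x y)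
      rw [hv.terminal, hV.2 y hy]
      simp only [pow_zero, CharP.cast_eq_zero, zero_mul, mul_one, add_zero]
      linarith
  · intro k t ht ht0 htI htI' hk hind
    -- A weight of order `1 / √h` balances the error of order `1 / g` against the terms `g τ` and
    -- `2dNgh`: all are of order `√h`.
    set g := 1 / u * (1 + R * τ) ^ k with hg
    have hpow1 : 1 ≤ (1 + R * τ) ^ k := one_le_pow₀ (by linarith [mul_nonneg hR0 hτ.le])
    have hpowΛ : (1 + R * τ) ^ k ≤ Λ := one_add_mul_pow_le_exp hR0 hτ.le (by linarith [htI.1])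
    have hg0 : 0 < g := by positivity
    have hgu : g * u = (1 + R * τ) ^ k := by rw [hg]; field_simp
    have hgτ : g * τ ≤ Λ * u := by
      calc g * τ ≤ g * u ^ 2 := mul_le_mul_of_nonneg_left hτu hg0.le
        _ = (g * u) * u := by ring
        _ ≤ Λ * u := by rw [hgu]; exact mul_le_mul_of_nonneg_right hpowΛ hu0.le
    have hgτ1 : g * τ ≤ Λ := hgτ.trans (mul_le_of_le_one_right hΛ0.le hu1)
    have hginv : 1 / (4 * g) ≤ u / 4 := by
      have : 1 ≤ g * u := by rw [hgu]; exact hpow1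
      rw [div_le_div_iff₀ (by positivity) (by norm_num)]
      linarith
    have he : (K + 1) * τ + 11 * K ^ 2 * g * τ +
        (K + g * τ * (4 * K ^ 2 + 4 * K)) ^ 2 / (4 * g) ≤ c₁ * u := by
      have a1 : (K + 1) * τ ≤ (K + 1) * u :=
        mul_le_mul_of_nonneg_left (hτu.trans hu21) (by linarith)
      have a2 : 11 * K ^ 2 * g * τ ≤ 11 * K ^ 2 * (Λ * u) := by
        rw [mul_assoc]
        exact mul_le_mul_of_nonneg_left hgτ (by positivity)
      have a3 : (K + g * τ * (4 * K ^ 2 + 4 * K)) ^ 2 / (4 * g) ≤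
          (K + Λ * (4 * K ^ 2 + 4 * K)) ^ 2 * (u / 4) := by
        rw [div_eq_mul_one_div]
        gcongr
      rw [hc₁]
      linarith
    have hB : K ^ 2 / 4 * u + k * τ * (c₂ * u) + τ * (c₁ * u + 2 * d * N * g * h) ≤
        K ^ 2 / 4 * u + ((k + 1 : ℕ) : ℝ) * τ * (c₂ * u) := by
      have b1 : 2 * d * N * g * h ≤ 2 * d * N * Λ * u := by
        have b2 : g * h ≤ Λ * u := by
          calc g * h = (g * u) * u := by rw [← hu2]; ring
            _ ≤ Λ * u := by rw [hgu]; exact mul_le_mul_of_nonneg_right hpowΛ hu0.le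
        have b3 := mul_le_mul_of_nonneg_left b2 (show 0 ≤ 2 * d * N by positivity)
        linarith
      have b4 : c₁ * u + 2 * d * N * g * h ≤ c₂ * u := by rw [hc₂]; linarith
      have b5 := mul_le_mul_of_nonneg_left b4 hτ.le
      push_cast
      linarith
    have hgs : 1 / u * (1 + R * τ) ^ (k + 1) = g * (1 + (2 * K + 1) * τ) := by
      rw [hg, pow_succ, hR]; ring
    have hstep : ∀ y ∈ spaceGrid d h, V (t - τ) y = V t y +
        τ * hamiltonian A c f t y (gradH h (V t) y) + τ * (N * h * laplH h (V t) y) :=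
      fun y hy => hV.step_eq hτ ht ht0 hy
    constructor
    · intro y hy x
      rw [hgs]
      exact (D.viscosity_le_step hv hh hτ hcfl htI htI' hstep hg0 he hind.1 hy x).trans
        (by linarith)
    · intro y hy x
      rw [hgs]
      exact (D.scheme_le_step hv hh hτ hcfl htI htI' hstep hg0 he hind.2 hy x).trans
        (by linarith)

end

/-! ### Convergence of discrete gradients -/

section
variable {d : ℕ}

/-- Componentwise rounding to the grid `h ℤᵈ`. -/
noncomputable def gridRound (h : ℝ) (x : Eu d) : Eu d :=
  WithLp.toLp 2 (fun i => h * ⌊x i / h⌋)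

theorem gridRound_mem (h : ℝ) (x : Eu d) : gridRound h x ∈ spaceGrid d h :=
  ⟨fun i => ⌊x i / h⌋, fun _ => rfl⟩

theorem tendsto_toLp {ι : Type*} {l : Filter ι} {F : ι → Eu d} {x : Eu d}
    (h : ∀ i, Tendsto (fun k => F k i) l (𝓝 (x i))) : Tendsto F l (𝓝 x) :=
  ((PiLp.continuous_toLp 2 (fun _ : Fin d => ℝ)).tendsto (WithLp.ofLp x)).comp
    (tendsto_pi_nhds.2 h)

theorem tendsto_mul_floor_div (s : ℝ) :
    Tendsto (fun h : ℝ => h * (⌊s / h⌋ : ℝ)) (𝓝[>] 0) (𝓝 s) := by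
  have h1 : Tendsto (fun h : ℝ => s - h) (𝓝[>] 0) (𝓝 s) := by
    have : Continuous (fun h : ℝ => s - h) := by fun_prop
    simpa using (this.tendsto 0).mono_left nhdsWithin_le_nhds
  refine tendsto_of_tendsto_of_tendsto_of_le_of_le' h1 tendsto_const_nhds ?_ ?_
  · filter_upwards [self_mem_nhdsWithin] with h (hh : 0 < h)
    have h2 := (Int.lt_floor_add_one (s / h)).le
    rw [div_le_iff₀ hh] at h2
    linarith
  · filter_upwards [self_mem_nhdsWithin] with h (hh : 0 < h)
    have h2 := Int.floor_le (s / h)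
    rw [le_div_iff₀ hh] at h2
    linarith

theorem tendsto_gridRound (x : Eu d) :
    Tendsto (fun h : ℝ => gridRound h x) (𝓝[>] 0) (𝓝 x) :=
  tendsto_toLp fun i => tendsto_mul_floor_div (x i)

/-- Comparison of a forward slope on the grid scale with a backward slope on a larger scale. -/
theorem GridJensen.slope_le {h η Γ : ℝ} {V : Eu d → ℝ} (hh : 0 < h) (hη : 0 < η) (hΓ : 0 ≤ Γ)
    (hV : GridJensen h (Γ * (1 + h / (η * h))) Γ (η * h) V) {w : Eu d} (hw : ‖w‖ = 1)
    (hwg : ∀ n : ℤ, (h * n) • w ∈ spaceGrid d h) {x : Eu d} (hx : x ∈ spaceGrid d h) {k : ℕ}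
    (hk : 0 < k) :
    (V (x + h • w) - V x) / h ≤
      (V x - V (x - (k * h) • w)) / (k * h) + 2 * (Γ * (1 + 1 / η) * (k * h) + Γ * η) := by
  have hk0 : (0 : ℝ) < k := by exact_mod_cast hk
  have hk1 : (1 : ℝ) ≤ k := by exact_mod_cast hk
  have hg1 : h • w ∈ spaceGrid d h := by simpa using hwg 1
  have hgk : ((k : ℝ) * h) • w ∈ spaceGrid d h := by
    have := hwg k
    rwa [Int.cast_natCast, mul_comm] at this
  -- A two-point law with mean `x`. Its mean displacement vanishes, so the regularised norm reduces
  -- to `κ = η h`, which remains small after division by `h`.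
  have key := hV Bool (fun b => if b then k / (k + 1) else 1 / (k + 1))
    (fun b => if b then x + h • w else x - (k * h) • w) x
    (by rintro (_ | _) <;> simp <;> positivity)
    (by simp; field_simp)
    (by
      rintro (_ | _)
      · simpa using spaceGrid_sub hx hgk
      · simpa using spaceGrid_add hx hg1) hx
  simp only [Fintype.sum_bool, if_true, Bool.false_eq_true, if_false, add_sub_cancel_left,
    sub_sub_cancel_left, norm_neg, norm_smul, hw, mul_one, Real.norm_eq_abs, sq_abs] at key
  have e0 : ((k : ℝ) / (k + 1)) • h • w + ((1 : ℝ) / (k + 1)) • -(((k : ℝ) * h) • w) = 0 := by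
    rw [← neg_smul, smul_smul, smul_smul, ← add_smul]
    have : (k : ℝ) / (k + 1) * h + 1 / (k + 1) * -(k * h) = 0 := by field_simp; ring
    rw [this, zero_smul]
  rw [e0, norm_zero, zero_pow two_ne_zero, add_zero, Real.sqrt_sq (by positivity)] at key
  have e1 : h / (η * h) = 1 / η := by field_simp
  rw [e1] at key
  set a := Γ * (1 + 1 / η) with ha
  have ha0 : 0 ≤ a := by positivity
  have e2 : (k : ℝ) / (k + 1) * h ^ 2 + 1 / (k + 1) * (k * h) ^ 2 = k * h ^ 2 := by
    field_simp
    ring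
  rw [e2] at key
  have h1 := mul_le_mul_of_nonneg_left key (show 0 ≤ ((k : ℝ) + 1) / (k * h) by positivity)
  have e3 : ((k : ℝ) + 1) / (k * h) * (k / (k + 1) * V (x + h • w) +
      1 / (k + 1) * V (x - (k * h) • w) - V x) =
      (V (x + h • w) - V x) / h - (V x - V (x - (k * h) • w)) / (k * h) := by
    field_simp
    ring
  have e4 : ((k : ℝ) + 1) / (k * h) * (a * (k * h ^ 2) + Γ * (η * h)) =
      (k + 1) / k * (a * (k * h) + Γ * η) := by
    field_simp
  rw [e3, e4] at h1
  have h2 : ((k : ℝ) + 1) / k ≤ 2 := by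
    rw [div_le_iff₀ hk0]
    linarith
  have h3 : ((k : ℝ) + 1) / k * (a * (k * h) + Γ * η) ≤ 2 * (a * (k * h) + Γ * η) :=
    mul_le_mul_of_nonneg_right h2 (by positivity)
  linarith

theorem gradient_apply (g : Eu d → ℝ) (x : Eu d) (i : Fin d) :
    gradient g x i = fderiv ℝ g x (stdVec i) := by
  have : inner ℝ (gradient g x) (stdVec i) = fderiv ℝ g x (stdVec i) := by
    simp [gradient]
  calc gradient g x i = inner ℝ (stdVec i) (gradient g x) := by
        rw [stdVec, EuclideanSpace.inner_single_left, map_one, one_mul]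
    _ = _ := by rw [real_inner_comm]; exact this

theorem timeGrid_subset_Icc {T τ : ℝ} (hτ : 0 ≤ τ) : timeGrid T τ ⊆ Icc 0 T := by
  rintro _ ⟨k, rfl, hk⟩
  exact ⟨by positivity, hk⟩

end

section
variable {d : ℕ} {T t Γ : ℝ} {H : ℝ → Eu d → Eu d → ℝ} {q : Eu d → ℝ} {v : ℝ → Eu d → ℝ}

/-- Convergence along grid points of approximations with a uniform rate. -/
theorem IsViscositySolution.tendsto_of_rate (hv : IsViscositySolution T H q v) {x : Eu d}
    {V : ℝ → ℝ → Eu d → ℝ} {th : ℝ → ℝ} {xh : ℝ → Eu d} (ht : t ∈ Icc 0 T)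
    (hrate : ∀ᶠ h in 𝓝[>] 0, |V h (th h) (xh h) - v (th h) (xh h)| ≤ Γ * √h)
    (hthI : ∀ᶠ h in 𝓝[>] 0, th h ∈ Icc 0 T) (hth : Tendsto th (𝓝[>] 0) (𝓝 t))
    (hxh : Tendsto xh (𝓝[>] 0) (𝓝 x)) :
    Tendsto (fun h => V h (th h) (xh h)) (𝓝[>] 0) (𝓝 (v t x)) := by
  have h1 : Tendsto (fun h => v (th h) (xh h)) (𝓝[>] 0) (𝓝 (v t x)) := by
    have hc := hv.continuousOn (t, x) ⟨ht, mem_univ _⟩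
    refine Tendsto.comp (f := fun h => (th h, xh h)) hc ?_
    refine tendsto_nhdsWithin_iff.2 ⟨hth.prodMk_nhds hxh, ?_⟩
    filter_upwards [hthI] with h hh using ⟨hh, mem_univ _⟩
  have h2 : Tendsto (fun h : ℝ => Γ * √h) (𝓝[>] 0) (𝓝 0) := by
    have : Continuous (fun h : ℝ => Γ * √h) := by fun_prop
    simpa using (this.tendsto 0).mono_left nhdsWithin_le_nhds
  have h3 : Tendsto (fun h => V h (th h) (xh h) - v (th h) (xh h)) (𝓝[>] 0) (𝓝 0) :=
    squeeze_zero_norm' hrate h2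
  simpa using h3.add h1

/-- One-sided convergence of discrete slopes at a point of differentiability of the limit. -/
theorem IsViscositySolution.eventually_slope_le (hv : IsViscositySolution T H q v) {x : Eu d}
    (hdiff : DifferentiableAt ℝ (v t) x) (hΓ : 0 < Γ)
    {V : ℝ → ℝ → Eu d → ℝ} {th : ℝ → ℝ} {xh : ℝ → Eu d} (ht : t ∈ Icc 0 T)
    (hrate : ∀ᶠ h in 𝓝[>] 0, ∀ y ∈ spaceGrid d h, |V h (th h) y - v (th h) y| ≤ Γ * √h)
    (hjen : ∀ᶠ h in 𝓝[>] 0, ∀ κ, 0 < κ → GridJensen h (Γ * (1 + h / κ)) Γ κ (V h (th h)))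
    (hthI : ∀ᶠ h in 𝓝[>] 0, th h ∈ Icc 0 T) (hth : Tendsto th (𝓝[>] 0) (𝓝 t))
    (hxg : ∀ᶠ h in 𝓝[>] 0, xh h ∈ spaceGrid d h)
    (hxh : Tendsto xh (𝓝[>] 0) (𝓝 x)) {w : Eu d} (hw : ‖w‖ = 1)
    (hwg : ∀ (h : ℝ) (n : ℤ), (h * n) • w ∈ spaceGrid d h) {δ : ℝ} (hδ : 0 < δ) :
    ∀ᶠ h in 𝓝[>] (0 : ℝ), (V h (th h) (xh h + h • w) - V h (th h) (xh h)) / h ≤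
      fderiv ℝ (v t) x w + δ := by
  -- The choice makes `2Γη = δ / 4`. Only then is `ε` chosen, since the quadratic error carries the
  -- factor `1 + 1 / η`.
  set η := δ / (8 * Γ) with hη
  have hη0 : 0 < η := by positivity
  have hslope : Tendsto (fun ε : ℝ => (v t x - v t (x - ε • w)) / ε) (𝓝[>] 0)
      (𝓝 (fderiv ℝ (v t) x w)) := by
    have h1 : HasDerivAt (fun ε : ℝ => v t (x - ε • w)) (fderiv ℝ (v t) x (-w)) 0 := by
      have h2 : HasDerivAt (fun ε : ℝ => x - ε • w) (-w) 0 := by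
        simpa using ((hasDerivAt_id (0 : ℝ)).smul_const w).const_sub x
      refine HasFDerivAt.comp_hasDerivAt (0 : ℝ) ?_ h2
      simpa using hdiff.hasFDerivAt
    have h3 := (hasDerivAt_iff_tendsto_slope.1 h1).mono_left
      (nhdsWithin_mono (0 : ℝ) (fun y (hy : 0 < y) => (ne_of_gt hy : y ≠ 0)))
    have h4 := h3.neg
    simp only [map_neg, neg_neg] at h4
    refine h4.congr fun ε => ?_
    simp only [slope_def_field, zero_smul, sub_zero]
    ring
  have hev1 : ∀ᶠ ε in 𝓝[>] (0 : ℝ), (v t x - v t (x - ε • w)) / ε <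
      fderiv ℝ (v t) x w + δ / 4 := hslope.eventually_lt_const (by linarith)
  have hev2 : ∀ᶠ ε in 𝓝[>] (0 : ℝ), 2 * (Γ * (1 + 1 / η) * ε) < δ / 4 := by
    have : Continuous (fun ε : ℝ => 2 * (Γ * (1 + 1 / η) * ε)) := by fun_prop
    have h5 := (this.tendsto 0).mono_left (nhdsWithin_le_nhds (s := Ioi 0))
    rw [mul_zero, mul_zero] at h5
    exact h5.eventually_lt_const (by linarith)
  obtain ⟨ε, ⟨hε1, hε2⟩, hε0 : 0 < ε⟩ := ((hev1.and hev2).and self_mem_nhdsWithin).exists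
  -- The backward slope is taken over `k h → ε`, a fixed scale on which convergence of values
  -- suffices; Jensen bridges the gap to scale `h`.
  set k : ℝ → ℕ := fun h => ⌊ε / h⌋₊ with hk
  have hkh : Tendsto (fun h : ℝ => (k h : ℝ) * h) (𝓝[>] 0) (𝓝 ε) := by
    refine (tendsto_mul_floor_div ε).congr' ?_
    filter_upwards [self_mem_nhdsWithin] with h (hh : 0 < h)
    rw [hk, mul_comm, natCast_floor_eq_intCast_floor (by positivity)]
  have hy : Tendsto (fun h => xh h - ((k h : ℝ) * h) • w) (𝓝[>] 0) (𝓝 (x - ε • w)) :=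
    hxh.sub (hkh.smul_const w)
  have hyg : ∀ᶠ h in 𝓝[>] 0, xh h - ((k h : ℝ) * h) • w ∈ spaceGrid d h := by
    filter_upwards [hxg] with h hx
    have := hwg h (k h)
    rw [Int.cast_natCast, mul_comm] at this
    exact spaceGrid_sub hx this
  have l1 := hv.tendsto_of_rate (V := V) (Γ := Γ) ht (by
    filter_upwards [hrate, hxg] with h h1 h2 using h1 _ h2) hthI hth hxh
  have l2 := hv.tendsto_of_rate (V := V) (Γ := Γ) ht (by
    filter_upwards [hrate, hyg] with h h1 h2 using h1 _ h2) hthI hth hy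
  have l3 := (l1.sub l2).div hkh hε0.ne'
  have hev3 := l3.eventually_lt_const (u := fderiv ℝ (v t) x w + δ / 4) hε1
  have hkpos : ∀ᶠ h in 𝓝[>] (0 : ℝ), 0 < (k h : ℝ) * h := hkh.eventually_const_lt hε0
  filter_upwards [hev3, hkpos, self_mem_nhdsWithin, hjen, hxg] with h a1 a2 (hh : 0 < h) a3 a4
  have hk0 : 0 < k h := by
    rcases Nat.eq_zero_or_pos (k h) with h0 | h0
    · rw [h0] at a2; simp at a2
    · exact h0
  have key := (a3 (η * h) (by positivity)).slope_le hh hη0 hΓ.le hw (hwg h) a4 hk0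
  have hkε : (k h : ℝ) * h ≤ ε := by
    have := Nat.floor_le (show 0 ≤ ε / h by positivity)
    rwa [le_div_iff₀ hh] at this
  have b1 : Γ * (1 + 1 / η) * ((k h : ℝ) * h) ≤ Γ * (1 + 1 / η) * ε :=
    mul_le_mul_of_nonneg_left hkε (by positivity)
  have b2 : Γ * η = δ / 8 := by rw [hη]; field_simp
  simp only [Pi.div_apply] at a1
  linarith

/-- Convergence of the discrete gradients at a point of differentiability of the limit. -/
theorem IsViscositySolution.tendsto_gradH (hv : IsViscositySolution T H q v) {x : Eu d}
    (hdiff : DifferentiableAt ℝ (v t) x) (hΓ : 0 < Γ)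
    {V : ℝ → ℝ → Eu d → ℝ} {th : ℝ → ℝ} {xh : ℝ → Eu d} (ht : t ∈ Icc 0 T)
    (hrate : ∀ᶠ h in 𝓝[>] 0, ∀ y ∈ spaceGrid d h, |V h (th h) y - v (th h) y| ≤ Γ * √h)
    (hjen : ∀ᶠ h in 𝓝[>] 0, ∀ κ, 0 < κ → GridJensen h (Γ * (1 + h / κ)) Γ κ (V h (th h)))
    (hthI : ∀ᶠ h in 𝓝[>] 0, th h ∈ Icc 0 T) (hth : Tendsto th (𝓝[>] 0) (𝓝 t))
    (hxg : ∀ᶠ h in 𝓝[>] 0, xh h ∈ spaceGrid d h)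
    (hxh : Tendsto xh (𝓝[>] 0) (𝓝 x)) :
    Tendsto (fun h => gradH h (V h (th h)) (xh h)) (𝓝[>] 0) (𝓝 (gradient (v t) x)) := by
  refine tendsto_toLp fun i => ?_
  rw [gradient_apply]
  have hshift : ∀ σ : ℝ, Tendsto (fun h => xh h + (σ * h) • stdVec i) (𝓝[>] 0) (𝓝 x) := by
    intro σ
    have : Continuous (fun h : ℝ => (σ * h) • (stdVec i : Eu d)) := by fun_prop
    have h1 := (this.tendsto 0).mono_left (nhdsWithin_le_nhds (s := Ioi 0))
    simpa using hxh.add h1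
  have hgrid : ∀ (h : ℝ) (n : ℤ), (h * n) • stdVec i ∈ spaceGrid d h := fun h n =>
    smul_stdVec_mem_spaceGrid h n i
  have hgrid' : ∀ (h : ℝ) (n : ℤ), (h * n) • -stdVec i ∈ spaceGrid d h := fun h n => by
    rw [smul_neg]
    exact spaceGrid_neg (hgrid h n)
  have hn : ‖(stdVec i : Eu d)‖ = 1 := by simp [stdVec]
  have hxp : ∀ᶠ h in 𝓝[>] 0, xh h + (1 * h) • stdVec i ∈ spaceGrid d h := by
    filter_upwards [hxg] with h hx
    rw [one_mul]
    exact spaceGrid_add hx (smul_stdVec_mem_spaceGrid_one h i)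
  have hxm : ∀ᶠ h in 𝓝[>] 0, xh h + (-1 * h) • stdVec i ∈ spaceGrid d h := by
    filter_upwards [hxg] with h hx
    rw [neg_one_mul, neg_smul, ← sub_eq_add_neg]
    exact spaceGrid_sub hx (smul_stdVec_mem_spaceGrid_one h i)
  rw [Metric.tendsto_nhds]
  intro δ hδ
  -- The central difference is the mean of two adjacent one-sided slopes. Bounds along `e_i` control
  -- it from above, bounds along `-e_i` from below.
  have s1 := hv.eventually_slope_le hdiff hΓ ht hrate hjen hthI hth hxg hxh hn hgrid (half_pos hδ)
  have s2 := hv.eventually_slope_le hdiff hΓ ht hrate hjen hthI hth hxm (hshift (-1)) hn hgrid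
    (half_pos hδ)
  have s3 := hv.eventually_slope_le hdiff hΓ ht hrate hjen hthI hth hxg hxh
    (by rwa [norm_neg]) hgrid' (half_pos hδ)
  have s4 := hv.eventually_slope_le hdiff hΓ ht hrate hjen hthI hth hxp (hshift 1)
    (by rwa [norm_neg]) hgrid' (half_pos hδ)
  filter_upwards [s1, s2, s3, s4, self_mem_nhdsWithin] with h a1 a2 a3 a4 (hh : 0 < h)
  simp only [one_mul, neg_one_mul, neg_smul, smul_neg, map_neg, sub_add_cancel,
    add_sub_cancel_right, ← sub_eq_add_neg] at a1 a2 a3 a4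
  rw [Real.dist_eq, abs_lt]
  simp only [gradH]
  set W := V h (th h)
  have e1 : (W (xh h + h • stdVec i) - W (xh h - h • stdVec i)) / (2 * h) =
      ((W (xh h + h • stdVec i) - W (xh h)) / h + (W (xh h) - W (xh h - h • stdVec i)) / h) / 2 := by
    field_simp
    ring
  have e2 : (W (xh h + h • stdVec i) - W (xh h - h • stdVec i)) / (2 * h) =
      -((W (xh h - h • stdVec i) - W (xh h)) / h +
        (W (xh h) - W (xh h + h • stdVec i)) / h) / 2 := by
    field_simp
    ring
  constructor
  · rw [e2]; linarith
  · rw [e1]; linarith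

end

/-! ### Passage to the limit -/

section
variable {d m : ℕ} {T t N K C Γ : ℝ} {A : Set (Eu m)} {c : ℝ → Eu d → Eu m → ℝ}
  {f : ℝ → Eu d → Eu m → Eu d} {H : ℝ → Eu d → Eu d → ℝ} {q : Eu d → ℝ} {v : ℝ → Eu d → ℝ}
  {α : ℝ → Eu d → Eu d → Eu m}

theorem ControlData.exists_gridJensen_and_rate (D : ControlData T N K C A c f q α) (hd : 0 < d)
    (hN : 1 ≤ N) (hv : IsViscositySolution T (hamiltonian A c f) q v) :
    ∃ Γ : ℝ, 0 < Γ ∧ ∀ (τ h : ℝ) (n : ℕ) (V : ℝ → Eu d → ℝ), 0 < τ → h ∈ Ioo (0 : ℝ) 1 →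
      2 * d * N * τ ≤ h → T = n * τ → IsGridSolution T N τ h (hamiltonian A c f) q V →
      ∀ t ∈ timeGrid T τ, (∀ κ, 0 < κ → GridJensen h (Γ * (1 + h / κ)) Γ κ (V t)) ∧
        ∀ y ∈ spaceGrid d h, |V t y - v t y| ≤ Γ * √h := by
  obtain ⟨Γ₁, hΓ₁, hJ⟩ := D.exists_gridJensen
  obtain ⟨Γ₂, hR⟩ := D.exists_abs_sub_le hd hN hv
  refine ⟨max Γ₁ Γ₂, lt_max_of_lt_left hΓ₁, ?_⟩
  intro τ h n V hτ hh hcfl hn hV t ht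
  have hh0 := hh.1
  refine ⟨fun κ hκ => ?_, fun y hy => ?_⟩
  · exact (hJ τ h κ n V hτ hh0 hκ hcfl hn hV t ht).mono
      (mul_le_mul_of_nonneg_right (le_max_left _ _) (by positivity)) (le_max_left _ _)
  · exact (hR τ h n V hτ hh0 hh.2.le hcfl hn hV t ht y hy).trans
      (mul_le_mul_of_nonneg_right (le_max_right _ _) (Real.sqrt_nonneg _))

/-- The discrete Jensen inequality passes to the limit. -/
theorem IsViscositySolution.jensen (hv : IsViscositySolution T H q v)
    {V : ℝ → ℝ → Eu d → ℝ} {th : ℝ → ℝ} (ht : t ∈ Icc 0 T)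
    (hrate : ∀ᶠ h in 𝓝[>] 0, ∀ y ∈ spaceGrid d h, |V h (th h) y - v (th h) y| ≤ Γ * √h)
    (hjen : ∀ᶠ h in 𝓝[>] 0, ∀ κ, 0 < κ → GridJensen h (Γ * (1 + h / κ)) Γ κ (V h (th h)))
    (hthI : ∀ᶠ h in 𝓝[>] 0, th h ∈ Icc 0 T) (hth : Tendsto th (𝓝[>] 0) (𝓝 t))
    {ι : Type} [Fintype ι] {p : ι → ℝ} (X : ι → Eu d) (x₀ : Eu d) (hp : ∀ k, 0 ≤ p k)
    (hp1 : ∑ k, p k = 1) :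
    ∑ k, p k * v t (X k) - v t x₀ ≤ Γ * ∑ k, p k * ‖X k - x₀‖ ^ 2 +
      Γ * ‖∑ k, p k • (X k - x₀)‖ := by
  have hpt : ∀ y : Eu d, Tendsto (fun h => V h (th h) (gridRound h y)) (𝓝[>] 0) (𝓝 (v t y)) :=
    fun y => hv.tendsto_of_rate ht
      (by filter_upwards [hrate] with h hh using hh _ (gridRound_mem h y)) hthI hth
      (tendsto_gridRound y)
  have hsub : ∀ k, Tendsto (fun h => gridRound h (X k) - gridRound h x₀) (𝓝[>] 0)
      (𝓝 (X k - x₀)) := fun k => (tendsto_gridRound _).sub (tendsto_gridRound _)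
  have hl : Tendsto (fun h => ∑ k, p k * V h (th h) (gridRound h (X k)) -
      V h (th h) (gridRound h x₀)) (𝓝[>] 0) (𝓝 (∑ k, p k * v t (X k) - v t x₀)) :=
    (tendsto_finsetSum _ fun k _ => (hpt (X k)).const_mul (p k)).sub (hpt x₀)
  have hsqrt : Tendsto (fun h : ℝ => √h) (𝓝[>] 0) (𝓝 0) := by
    simpa using (Real.continuous_sqrt.tendsto 0).mono_left (nhdsWithin_le_nhds (s := Ioi 0))
  have hA : Tendsto (fun h : ℝ => Γ * (1 + √h)) (𝓝[>] 0) (𝓝 Γ) := by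
    simpa using (hsqrt.const_add 1).const_mul Γ
  have hS : Tendsto (fun h => ∑ k, p k * ‖gridRound h (X k) - gridRound h x₀‖ ^ 2) (𝓝[>] 0)
      (𝓝 (∑ k, p k * ‖X k - x₀‖ ^ 2)) :=
    tendsto_finsetSum _ fun k _ => ((hsub k).norm.pow 2).const_mul (p k)
  have hM : Tendsto (fun h => √((√h) ^ 2 +
      ‖∑ k, p k • (gridRound h (X k) - gridRound h x₀)‖ ^ 2)) (𝓝[>] 0)
      (𝓝 ‖∑ k, p k • (X k - x₀)‖) := by
    have h1 := (tendsto_finsetSum Finset.univ fun k _ => (hsub k).const_smul (p k)).norm.pow 2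
    have h2 := (Real.continuous_sqrt.tendsto _).comp ((hsqrt.pow 2).add h1)
    simpa [Function.comp_def, Real.sqrt_sq (norm_nonneg _)] using h2
  refine le_of_tendsto_of_tendsto hl ((hA.mul hS).add (hM.const_mul Γ)) ?_
  filter_upwards [hjen, self_mem_nhdsWithin] with h hj (hh : 0 < h)
  -- With `κ = √h` both `κ` and `h / κ` tend to zero.
  have := hj (√h) (Real.sqrt_pos.2 hh) ι p (fun k => gridRound h (X k)) (gridRound h x₀) hp hp1
    (fun k => gridRound_mem h _) (gridRound_mem h _)
  rwa [Real.div_sqrt] at this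

/-- Auxiliary grid solutions satisfying the CFL condition, with grid times tending to `t`, carry the
discrete inequality over to `v t`; `Γ` does not depend on `t`. -/
theorem ControlData.exists_jensen (D : ControlData T N K C A c f q α) (hT : 0 < T) (hd : 0 < d)
    (hN : 1 ≤ N) (hv : IsViscositySolution T (hamiltonian A c f) q v) :
    ∃ Γ : ℝ, 0 < Γ ∧ ∀ t ∈ Icc (0 : ℝ) T, ∀ (ι : Type) [Fintype ι] (p : ι → ℝ) (X : ι → Eu d)
      (x₀ : Eu d), (∀ k, 0 ≤ p k) → ∑ k, p k = 1 →
      ∑ k, p k * v t (X k) - v t x₀ ≤ Γ * ∑ k, p k * ‖X k - x₀‖ ^ 2 +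
        Γ * ‖∑ k, p k • (X k - x₀)‖ := by
  obtain ⟨Γ, hΓ, hG⟩ := D.exists_gridJensen_and_rate hd hN hv
  refine ⟨Γ, hΓ, fun t ht ι _ p X x₀ hp hp1 => ?_⟩
  have hd1 : (1 : ℝ) ≤ d := by exact_mod_cast hd
  have hdN : 0 < 2 * (d : ℝ) * N := by positivity
  have hex : ∀ h : ℝ, ∃ (τ s : ℝ) (V : ℝ → Eu d → ℝ), 0 < h → 0 < τ ∧ τ ≤ h ∧
      2 * d * N * τ ≤ h ∧ (∃ n : ℕ, T = n * τ) ∧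
      IsGridSolution T N τ h (hamiltonian A c f) q V ∧ s ∈ timeGrid T τ ∧ |s - t| ≤ h := by
    intro h
    by_cases hh : 0 < h
    swap
    · exact ⟨0, 0, 0, fun h0 => absurd h0 hh⟩
    obtain ⟨n, hn⟩ := exists_nat_gt (2 * d * N * T / h)
    have hn0 : (0 : ℝ) < n := lt_trans (by positivity) hn
    have hτ : 0 < T / n := by positivity
    have hTn : T = n * (T / n) := by field_simp
    have hcfl : 2 * d * N * (T / n) ≤ h := by
      rw [div_lt_iff₀ hh] at hn
      rw [← mul_div_assoc, div_le_iff₀ hn0]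
      linarith
    have hτh : T / n ≤ h := by
      refine le_trans ?_ hcfl
      have : 1 ≤ 2 * (d : ℝ) * N := by nlinarith
      nlinarith
    obtain ⟨V, hV⟩ := exists_isGridSolution hτ hTn N h (hamiltonian A c f) q
    have hfl := Nat.floor_le (show 0 ≤ t / (T / n) from div_nonneg ht.1 hτ.le)
    have hfl' := Nat.lt_floor_add_one (t / (T / n))
    rw [le_div_iff₀ hτ] at hfl
    rw [div_lt_iff₀ hτ] at hfl'
    refine ⟨T / n, ⌊t / (T / n)⌋₊ * (T / n), V, fun _ => ⟨hτ, hτh, hcfl, ⟨n, hTn⟩, hV,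
      ⟨_, rfl, hfl.trans ht.2⟩, ?_⟩⟩
    rw [abs_le]
    constructor <;> linarith
  choose τ s V hex using hex
  have hmem : ∀ᶠ h in 𝓝[>] (0 : ℝ), h ∈ Ioo (0 : ℝ) 1 := Ioo_mem_nhdsGT one_pos
  have hall : ∀ᶠ h in 𝓝[>] (0 : ℝ), (∀ κ, 0 < κ →
      GridJensen h (Γ * (1 + h / κ)) Γ κ (V h (s h))) ∧
        ∀ y ∈ spaceGrid d h, |V h (s h) y - v (s h) y| ≤ Γ * √h := by
    filter_upwards [hmem] with h hh
    obtain ⟨h1, -, h3, ⟨n, h4⟩, h5, h6, -⟩ := hex h hh.1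
    exact hG _ h n _ h1 hh h3 h4 h5 _ h6
  refine hv.jensen (V := V) (th := s) ht (hall.mono fun _ h => h.2) (hall.mono fun _ h => h.1)
    ?_ ?_ X x₀ hp hp1
  · filter_upwards [hmem] with h hh
    exact timeGrid_subset_Icc (hex h hh.1).1.le (hex h hh.1).2.2.2.2.2.1
  · rw [tendsto_iff_dist_tendsto_zero]
    refine squeeze_zero' (Eventually.of_forall fun _ => dist_nonneg)
      (?_ : ∀ᶠ h in 𝓝[>] (0 : ℝ), dist (s h) t ≤ h) (tendsto_id.mono_left nhdsWithin_le_nhds)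
    filter_upwards [hmem] with h hh
    exact (hex h hh.1).2.2.2.2.2.2

theorem semiconcaveWith_of_jensen {g : Eu d → ℝ}
    (hg : ∀ (ι : Type) [Fintype ι] (p : ι → ℝ) (X : ι → Eu d) (x₀ : Eu d), (∀ k, 0 ≤ p k) →
      ∑ k, p k = 1 → ∑ k, p k * g (X k) - g x₀ ≤ Γ * ∑ k, p k * ‖X k - x₀‖ ^ 2 +
        Γ * ‖∑ k, p k • (X k - x₀)‖) : SemiconcaveWith (2 * Γ) g := by
  intro x y
  have := hg Bool (fun _ => 1 / 2) (fun b => if b then x + y else x - y) x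
    (fun _ => by norm_num) (by simp)
  simp only [Fintype.sum_bool, if_true, Bool.false_eq_true, if_false, add_sub_cancel_left,
    sub_sub_cancel_left, norm_neg, smul_neg, add_neg_cancel, norm_zero, mul_zero] at this
  linarith

/-- One-point laws give `g x - g y ≤ Γ ‖x - y‖² + Γ ‖x - y‖`, which is a Lipschitz bound within
distance one; farther apart, boundedness is enough. -/
theorem lipschitzWith_of_jensen {g : Eu d → ℝ} {M : ℝ} (hΓ : 0 ≤ Γ) (hM : ∀ x, |g x| ≤ M)
    (hg : ∀ (ι : Type) [Fintype ι] (p : ι → ℝ) (X : ι → Eu d) (x₀ : Eu d), (∀ k, 0 ≤ p k) →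
      ∑ k, p k = 1 → ∑ k, p k * g (X k) - g x₀ ≤ Γ * ∑ k, p k * ‖X k - x₀‖ ^ 2 +
        Γ * ‖∑ k, p k • (X k - x₀)‖) : LipschitzWith (2 * Γ + 2 * M).toNNReal g := by
  have hM0 : 0 ≤ M := (abs_nonneg _).trans (hM 0)
  refine LipschitzWith.of_le_add_mul _ fun x y => ?_
  rw [Real.coe_toNNReal _ (by positivity), dist_eq_norm]
  have h1 := hg Unit (fun _ => 1) (fun _ => x) y (fun _ => zero_le_one) (by simp)
  simp only [Finset.univ_unique, Finset.sum_singleton, one_mul, one_smul] at h1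
  have h2 := abs_le.1 (hM x)
  have h3 := abs_le.1 (hM y)
  rcases le_total ‖x - y‖ 1 with h4 | h4
  · have : ‖x - y‖ ^ 2 ≤ ‖x - y‖ := by nlinarith [norm_nonneg (x - y)]
    nlinarith [norm_nonneg (x - y)]
  · nlinarith [norm_nonneg (x - y)]

theorem PolicyLipschitz.tendsto (hα : PolicyLipschitz T α) {ι : Type*} {l : Filter ι} {s : ι → ℝ}
    {X P : ι → Eu d} {x p : Eu d} (ht : t ∈ Icc 0 T) (hs : ∀ᶠ k in l, s k ∈ Icc 0 T)
    (hst : Tendsto s l (𝓝 t)) (hX : Tendsto X l (𝓝 x)) (hP : Tendsto P l (𝓝 p)) :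
    Tendsto (fun k => α (s k) (X k) (P k)) l (𝓝 (α t x p)) := by
  obtain ⟨K, hK⟩ := hα
  rw [tendsto_iff_norm_sub_tendsto_zero]
  refine squeeze_zero' (Eventually.of_forall fun _ => norm_nonneg _)
    (hs.mono fun k hk => hK _ hk _ ht _ _ _ _) ?_
  have h1 := (tendsto_iff_norm_sub_tendsto_zero.1 hst).add
    ((tendsto_iff_norm_sub_tendsto_zero.1 hX).add (tendsto_iff_norm_sub_tendsto_zero.1 hP))
  simpa [add_assoc] using h1.const_mul K

end

/-! ### The theorem -/

theorem theorem4p10 {d m : ℕ} (T : ℝ) (hT : 0 < T) (A : Set (Eu m)) (hA : IsCompact A)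
    (c : ℝ → Eu d → Eu m → ℝ) (f : ℝ → Eu d → Eu m → Eu d) (q : Eu d → ℝ)
    (α : ℝ → Eu d → Eu d → Eu m) (hα : IsArgminPolicy T A c f α)
    (hdata : DataBoundedLipschitz T A c f q) (hαLip : PolicyLipschitz T α)
    (hsecond : DataSecondOrder T A c f q)
    (N : ℝ) (hN : 1 ≤ N) (hNf : ∀ t ∈ Icc (0 : ℝ) T, ∀ x : Eu d, ∀ a ∈ A, ‖f t x a‖ / 2 ≤ N)
    (v : ℝ → Eu d → ℝ) (hv : IsViscositySolution T (hamiltonian A c f) q v) :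
    (∃ C : ℝ, 0 < C ∧ ∀ t ∈ Icc (0 : ℝ) T, SemiconcaveWith C (v t)) ∧
    ∀ t ∈ Icc (0 : ℝ) T, ∀ᵐ x : Eu d, DifferentiableAt ℝ (v t) x ∧
      ∀ (τ : ℝ → ℝ) (V : ℝ → ℝ → Eu d → ℝ) (th : ℝ → ℝ) (xh : ℝ → Eu d),
        (∀ h ∈ Ioo (0 : ℝ) 1,
          0 < τ h ∧ 2 * (d : ℝ) * N * τ h ≤ h ∧ (∃ n : ℕ, 0 < n ∧ T = n * τ h) ∧
          IsGridSolution T N (τ h) h (hamiltonian A c f) q (V h) ∧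
          th h ∈ timeGrid T (τ h) ∧ xh h ∈ spaceGrid d h) →
        Tendsto th (𝓝[>] 0) (𝓝 t) → Tendsto xh (𝓝[>] 0) (𝓝 x) →
        Tendsto (fun h => α (th h) (xh h) (gradH h (V h (th h)) (xh h))) (𝓝[>] 0)
          (𝓝 (α t x (gradient (v t) x))) := by
  have hmem : ∀ᶠ h in 𝓝[>] (0 : ℝ), h ∈ Ioo (0 : ℝ) 1 := Ioo_mem_nhdsGT one_pos
  rcases Nat.eq_zero_or_pos d with rfl | hd
  -- In dimension zero the CFL condition does not restrict `τ`, but space is a single point and all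
  -- gradients coincide.
  · refine ⟨⟨1, one_pos, fun t _ x y => ?_⟩, fun t ht => Eventually.of_forall fun x => ⟨?_, ?_⟩⟩
    · rw [Subsingleton.elim (x + y) x, Subsingleton.elim (x - y) x]
      nlinarith [sq_nonneg ‖y‖]
    · exact (hasFDerivAt_of_subsingleton _ x).differentiableAt
    · intro τ V th xh hall hth hxh
      refine hαLip.tendsto ht ?_ hth hxh ?_
      · filter_upwards [hmem] with h hh
        exact timeGrid_subset_Icc (hall h hh).1.le (hall h hh).2.2.2.2.1
      · exact tendsto_const_nhds.congr fun _ => Subsingleton.elim _ _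
  obtain ⟨K, C, D⟩ := exists_controlData hα hdata hsecond hNf
  obtain ⟨Γ, hΓ, hJ⟩ := D.exists_jensen hT hd hN hv
  refine ⟨⟨2 * Γ, by positivity, fun t ht => semiconcaveWith_of_jensen (hJ t ht)⟩, ?_⟩
  intro t ht
  obtain ⟨M, hM⟩ := hv.bounded
  obtain ⟨Γ', hΓ', hG⟩ := D.exists_gridJensen_and_rate hd hN hv
  -- Rademacher's theorem. The exceptional null set depends on `v t` alone, not on the family of
  -- schemes.
  filter_upwards [(lipschitzWith_of_jensen hΓ.le (hM t ht) (hJ t ht)).ae_differentiableAt]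
    with x hx
  refine ⟨hx, ?_⟩
  intro τ V th xh hall hth hxh
  have hall' : ∀ᶠ h in 𝓝[>] (0 : ℝ), (∀ κ, 0 < κ →
      GridJensen h (Γ' * (1 + h / κ)) Γ' κ (V h (th h))) ∧
        ∀ y ∈ spaceGrid d h, |V h (th h) y - v (th h) y| ≤ Γ' * √h := by
    filter_upwards [hmem] with h hh
    obtain ⟨h1, h3, ⟨n, -, h4⟩, h5, h6, -⟩ := hall h hh
    exact hG _ h n _ h1 hh h3 h4 h5 _ h6
  have hthI : ∀ᶠ h in 𝓝[>] (0 : ℝ), th h ∈ Icc 0 T := by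
    filter_upwards [hmem] with h hh
    exact timeGrid_subset_Icc (hall h hh).1.le (hall h hh).2.2.2.2.1
  exact hαLip.tendsto ht hthI hth hxh
    (hv.tendsto_gradH hx hΓ' ht (hall'.mono fun _ h => h.2) (hall'.mono fun _ h => h.1) hthI hth
      (hmem.mono fun h hh => (hall h hh).2.2.2.2.2) hxh)
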